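/- Let $\mathbb H^2$ be the hyperbolic plane of curvature $-1$, let $K\subset\mathbb H^2$ be a convex body (a compact, geodesically convex set with non-empty interior), let $O\in\mathbb H^2$ be any point (inside, on, or outside $K$), and measure central angles at $O$ from any fixed direction. For each angle $\omega$ let $c_\omega$ be the unit speed geodesic with $c_\omega(0)=O$ that leaves $O$ in the direction $\omega$. Then for every $\omega$ there is exactly one real number $r=r(\omega)$ for which there is a support line of $K$ that is perpendicular to $c_\omega$ at the point $c_\omega(r)$ and bounds a closed half-plane that contains $K$ and does not contain $c_\omega(t)$ for $t>r$. Thus $c_\omega(r)$ is the point of the support line closest to $O$, $\omega$ is its central angle, and $r$ is the signed distance from $O$ to the support line (if $r<0$, that is, if the line strictly separates $O$ from $K$, the closest point has signed polar coordinates $(r,\omega)$; if $r=0$, then $\omega$ is the direction at $O$ normal to the line and pointing away from $K$). The perimeter $\mathcal P$ of $K$, that is, the length of $\partial K$, is finite, $\sinh r(\omega)$ is integrable over $[0,2\pi]$, and $$\mathcal P=\int_0^{2\pi}\sinh r(\omega)\,d\omega .$$ -/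

import Mathlib

open MeasureTheory UpperHalfPlane

namespace HypCauchy

/- The hyperbolic plane of curvature `-1` is the upper half-plane `ℍ` with Mathlib's metric,
the distance of the Riemannian metric `(dx² + dy²) / y²`. -/

/-- The set `K` is geodesically convex: with two points it contains the geodesic segment
between them, that is, all points at which the triangle inequality is an equality. -/
def GeodConvex (K : Set ℍ) : Prop :=
  ∀ x ∈ K, ∀ y ∈ K, ∀ z : ℍ, dist x z + dist z y = dist x y → z ∈ K

/-- A convex body: a compact convex set with interior points. -/
structure IsConvexBody (K : Set ℍ) : Prop where
  isCompact : IsCompact K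
  convex : GeodConvex K
  interior_nonempty : (interior K).Nonempty

/-- The perimeter of `K`: the length of its boundary, as the one-dimensional Hausdorff measure
for the hyperbolic metric. -/
noncomputable def perimeter (K : Set ℍ) : ENNReal := Measure.hausdorffMeasure 1 (frontier K)

/-- A geodesic line: the image of an isometric embedding of `ℝ`. -/
def IsGeodesicLine (L : Set ℍ) : Prop := ∃ γ : ℝ → ℍ, Isometry γ ∧ Set.range γ = L

/-- The geodesic segment from `x` to `y` meets `L`. -/
def SegmentMeets (L : Set ℍ) (x y : ℍ) : Prop := ∃ p ∈ L, dist x p + dist p y = dist x y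

lemma cosh_sub_sinh_mul_sin_pos (θ t : ℝ) :
    0 < Real.cosh t - Real.sinh t * Real.sin θ := by
  have h1 : |Real.sinh t * Real.sin θ| ≤ |Real.sinh t| := by
    rw [abs_mul]
    exact mul_le_of_le_one_right (abs_nonneg _) (Real.abs_sin_le_one θ)
  have h2 : |Real.sinh t| < Real.cosh t :=
    abs_lt_of_sq_lt_sq (by nlinarith [Real.cosh_sq t]) (Real.cosh_pos t).le
  linarith [le_abs_self (Real.sinh t * Real.sin θ)]

/-- Geodesic polar coordinates at `O`: the point at signed distance `t` from `O` along the
geodesic that leaves `O` in the direction of angle `θ`. As a function of `t` this is a unit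
speed geodesic through `O`, with initial velocity `O.im * exp (i θ)` in `ℂ`; as the half-plane
model is conformal, `θ` is the hyperbolic angle at `O`, counterclockwise from the positive
horizontal direction. -/
noncomputable def polar (O : ℍ) (θ t : ℝ) : ℍ :=
  ⟨⟨O.re + O.im * (Real.sinh t * Real.cos θ / (Real.cosh t - Real.sinh t * Real.sin θ)),
    O.im / (Real.cosh t - Real.sinh t * Real.sin θ)⟩,
    div_pos O.im_pos (cosh_sub_sinh_mul_sin_pos θ t)⟩

/-- `L` is the support line of `K` whose point closest to `O` has signed polar coordinates
`(s, θ)` about `O`, where `θ` is the direction pointing away from `K`; thus `s` is the signed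
distance from `O` to `L`, with `s > 0` if `O` is strictly on the side of `K`, `s = 0` if `O` is
on `L`, and `s < 0` if `L` separates `O` from `K`. -/
structure IsSupportLineAt (K : Set ℍ) (O : ℍ) (θ s : ℝ) (L : Set ℍ) : Prop where
  isGeodesicLine : IsGeodesicLine L
  foot_mem : polar O θ s ∈ L
  /-- `polar O θ s` is the point of `L` closest to `O` (the case `t = 0`) and to all other points
  of the geodesic through `O` in the direction `θ`; that is, `L` is orthogonal to this geodesic
  at `polar O θ s`. The values `t ≠ 0` matter only if `L` passes through `O`. -/
  closest : ∀ t : ℝ, ∀ p ∈ L, dist (polar O θ t) (polar O θ s) ≤ dist (polar O θ t) p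
  touches : (L ∩ K).Nonempty
  /-- `K` lies in the closed half-plane of `L` from which the direction `θ` points away: every
  point of `K` is on `L` or is separated by `L` from the points beyond `polar O θ s`. -/
  oneSided : ∀ z ∈ K, ∀ t > s, SegmentMeets L z (polar O θ t)

end HypCauchy

namespace HypCauchy

open Real Set Filter Topology

/-! ### Hyperboloid coordinates about a point -/

/-! The proof is a Cauchy–Crofton argument about the fixed point `O`. Let `lev O ω z` be the
hyperbolic sine of the signed coordinate of the projection of `z` to the geodesic through `O` in the
direction `ω`. Its level sets are the geodesics perpendicular to that one; in the Klein model
centred at `O` they are the chords perpendicular to `ω`. Hence the maximum `supp K O ω` of `lev O ω`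
over `K` is the sinh of the support distance. Existence of the support line is read off the level
set (`isSupportLineAt_lev`); uniqueness holds because the metric definition of orthogonality forces
the line into a level set (`IsSupportLineAt.subset_lev`).

The central identity is `integral_abs_lev_sub`: the integral over `[0, 2π]` of `|lev O ω z - lev O ω
w|` is four times the distance of `z` and `w`. It holds because `lev` is the derivative in `ω` of
the arsinh of the transverse coordinate.

Fix `ω` and run once around the boundary of `K`. A chord through the interior meets the boundary at
most twice, so `lev O ω` has total variation twice its maximum minus its minimum. The minimum is `-
supp K O (ω + π)`, so integrating over `ω` gives four times the integral of `supp`; by the identity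
it also gives four times the length. For the Hausdorff measure this becomes two estimates: diameters
of short arcs bound it from above (`IsConvexBody.perimeter_le`), chords of disjoint arcs from below
(`IsConvexBody.perimeter_eq`). -/

/-- First spacelike hyperboloid coordinate of `z` about `O`. -/
noncomputable def hx (O z : ℍ) : ℝ := (z.re - O.re) / z.im

/-- Timelike hyperboloid coordinate of `z` about `O`. -/
noncomputable def hz (O z : ℍ) : ℝ :=
  ((z.re - O.re) ^ 2 + z.im ^ 2 + O.im ^ 2) / (2 * z.im * O.im)

/-- Second spacelike hyperboloid coordinate of `z` about `O`. -/
noncomputable def hy (O z : ℍ) : ℝ := hz O z - O.im / z.im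

lemma hz_sq (O z : ℍ) : hz O z ^ 2 = 1 + hx O z ^ 2 + hy O z ^ 2 := by
  have h1 := z.im_pos.ne'
  have h2 := O.im_pos.ne'
  simp only [hx, hy, hz]
  field_simp
  ring

lemma hz_pos (O z : ℍ) : 0 < hz O z := by
  have h1 := z.im_pos
  have h2 := O.im_pos
  unfold hz
  positivity

/-- The right side is the negated Lorentz product of the two hyperboloid points. -/
lemma cosh_dist_eq (O z w : ℍ) :
    cosh (dist z w) = hz O z * hz O w - hx O z * hx O w - hy O z * hy O w := by
  have h1 := z.im_pos.ne'
  have h2 := O.im_pos.ne'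
  have h3 := w.im_pos.ne'
  rw [UpperHalfPlane.cosh_dist, Complex.dist_eq, Complex.sq_norm, Complex.normSq_apply]
  simp only [hx, hy, hz, Complex.sub_re, Complex.sub_im, coe_re, coe_im]
  field_simp
  ring

lemma continuous_hx (O : ℍ) : Continuous (hx O) := by
  unfold hx
  exact (UpperHalfPlane.continuous_re.sub continuous_const).div UpperHalfPlane.continuous_im
    fun z => z.im_pos.ne'

lemma continuous_hz (O : ℍ) : Continuous (hz O) := by
  unfold hz
  refine Continuous.div ?_ ?_ fun z => ?_
  · exact (((UpperHalfPlane.continuous_re.sub continuous_const).pow 2).add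
      (UpperHalfPlane.continuous_im.pow 2)).add continuous_const
  · exact (continuous_const.mul UpperHalfPlane.continuous_im).mul continuous_const
  · have h1 := z.im_pos
    have h2 := O.im_pos
    positivity

lemma continuous_hy (O : ℍ) : Continuous (hy O) := by
  unfold hy
  exact (continuous_hz O).sub
    (continuous_const.div UpperHalfPlane.continuous_im fun z => z.im_pos.ne')

lemma ext_of_hyp {O z w : ℍ} (h1 : hx O z = hx O w) (h2 : hy O z = hy O w) : z = w := by
  have h3 : hz O z = hz O w := by
    have := hz_sq O z
    rw [h1, h2, ← hz_sq O w] at this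
    exact (pow_left_inj₀ (hz_pos O z).le (hz_pos O w).le two_ne_zero).1 this
  have h := cosh_dist_eq O z w
  rw [h1, h2, h3, ← pow_two, ← pow_two, ← pow_two, hz_sq] at h
  have h4 : cosh (dist z w) = 1 := by rw [h]; ring
  by_contra hne
  exact absurd h4 (ne_of_gt (Real.one_lt_cosh.2 (dist_pos.2 hne).ne'))

lemma sqrt_sub_pos (a b : ℝ) : 0 < √(1 + a ^ 2 + b ^ 2) - b := by
  have : b < √(1 + a ^ 2 + b ^ 2) := by
    apply Real.lt_sqrt_of_sq_lt
    nlinarith [sq_nonneg a]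
  linarith

/-- The point with given spacelike hyperboloid coordinates about `O`. -/
noncomputable def ofHyp (O : ℍ) (a b : ℝ) : ℍ :=
  ⟨⟨O.re + O.im * (a / (√(1 + a ^ 2 + b ^ 2) - b)), O.im / (√(1 + a ^ 2 + b ^ 2) - b)⟩,
    div_pos O.im_pos (sqrt_sub_pos a b)⟩

lemma ofHyp_re (O : ℍ) (a b : ℝ) :
    (ofHyp O a b).re = O.re + O.im * (a / (√(1 + a ^ 2 + b ^ 2) - b)) := rfl

lemma ofHyp_im (O : ℍ) (a b : ℝ) :
    (ofHyp O a b).im = O.im / (√(1 + a ^ 2 + b ^ 2) - b) := rfl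

lemma hx_ofHyp (O : ℍ) (a b : ℝ) : hx O (ofHyp O a b) = a := by
  have h1 := (sqrt_sub_pos a b).ne'
  have h2 := O.im_pos.ne'
  simp only [hx, ofHyp_re, ofHyp_im]
  field_simp
  ring

lemma hz_ofHyp (O : ℍ) (a b : ℝ) : hz O (ofHyp O a b) = √(1 + a ^ 2 + b ^ 2) := by
  have h1 := (sqrt_sub_pos a b).ne'
  have h2 := O.im_pos.ne'
  have h3 : √(1 + a ^ 2 + b ^ 2) ^ 2 = 1 + a ^ 2 + b ^ 2 := Real.sq_sqrt (by positivity)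
  simp only [hz, ofHyp_re, ofHyp_im]
  set s := √(1 + a ^ 2 + b ^ 2)
  field_simp
  linear_combination (-O.im ^ 2) * h3

lemma hy_ofHyp (O : ℍ) (a b : ℝ) : hy O (ofHyp O a b) = b := by
  have h1 := (sqrt_sub_pos a b).ne'
  have h2 := O.im_pos.ne'
  rw [hy, hz_ofHyp, ofHyp_im]
  field_simp
  ring

lemma continuous_ofHyp (O : ℍ) : Continuous fun p : ℝ × ℝ => ofHyp O p.1 p.2 := by
  rw [UpperHalfPlane.isEmbedding_coe.continuous_iff]
  have hd : Continuous fun p : ℝ × ℝ => √(1 + p.1 ^ 2 + p.2 ^ 2) - p.2 := by fun_prop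
  have h1 : Continuous fun p : ℝ × ℝ =>
      O.re + O.im * (p.1 / (√(1 + p.1 ^ 2 + p.2 ^ 2) - p.2)) :=
    continuous_const.add (continuous_const.mul (continuous_fst.div hd
      fun p => (sqrt_sub_pos p.1 p.2).ne'))
  have h2 : Continuous fun p : ℝ × ℝ => O.im / (√(1 + p.1 ^ 2 + p.2 ^ 2) - p.2) :=
    continuous_const.div hd fun p => (sqrt_sub_pos p.1 p.2).ne'
  exact Complex.equivRealProdCLM.symm.continuous.comp (h1.prodMk h2)

/-! ### Coordinates along and across a direction -/

/-- Component of the hyperboloid point in the direction `ω`. -/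
noncomputable def pc (O : ℍ) (ω : ℝ) (z : ℍ) : ℝ := hx O z * cos ω + hy O z * sin ω

/-- Component of the hyperboloid point across the direction `ω`. -/
noncomputable def qc (O : ℍ) (ω : ℝ) (z : ℍ) : ℝ := hx O z * sin ω - hy O z * cos ω

lemma one_add_qc_sq (O : ℍ) (ω : ℝ) (z : ℍ) :
    1 + qc O ω z ^ 2 = hz O z ^ 2 - pc O ω z ^ 2 := by
  rw [hz_sq, pc, qc]
  linear_combination (hx O z ^ 2 + hy O z ^ 2) * sin_sq_add_cos_sq ω

lemma cosh_dist_eq_pc_qc (O : ℍ) (ω : ℝ) (z w : ℍ) :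
    cosh (dist z w) = hz O z * hz O w - pc O ω z * pc O ω w - qc O ω z * qc O ω w := by
  rw [cosh_dist_eq O, pc, qc, pc, qc]
  linear_combination (hx O z * hx O w + hy O z * hy O w) * sin_sq_add_cos_sq ω

lemma ext_of_pc_qc {O z w : ℍ} (ω : ℝ) (h1 : pc O ω z = pc O ω w) (h2 : qc O ω z = qc O ω w) :
    z = w := by
  have hx' (z : ℍ) : hx O z = pc O ω z * cos ω + qc O ω z * sin ω := by
    rw [pc, qc]; linear_combination (- hx O z) * sin_sq_add_cos_sq ω
  have hy' (z : ℍ) : hy O z = pc O ω z * sin ω - qc O ω z * cos ω := by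
    rw [pc, qc]; linear_combination (- hy O z) * sin_sq_add_cos_sq ω
  apply ext_of_hyp (O := O)
  · rw [hx' z, hx' w, h1, h2]
  · rw [hy' z, hy' w, h1, h2]

lemma exists_pc_qc (O : ℍ) (ω a b : ℝ) : ∃ z, pc O ω z = a ∧ qc O ω z = b := by
  refine ⟨ofHyp O (a * cos ω + b * sin ω) (a * sin ω - b * cos ω), ?_, ?_⟩
  · rw [pc, hx_ofHyp, hy_ofHyp]; linear_combination a * sin_sq_add_cos_sq ω
  · rw [qc, hx_ofHyp, hy_ofHyp]; linear_combination b * sin_sq_add_cos_sq ω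

/-- The hyperbolic sine of the signed coordinate of (the projection of) `z` along the geodesic
through `O` in the direction `ω`. -/
noncomputable def lev (O : ℍ) (ω : ℝ) (z : ℍ) : ℝ := pc O ω z / √(1 + qc O ω z ^ 2)

/-- The Klein model centred at `O`. -/
noncomputable def klein (O z : ℍ) : ℂ := ⟨hx O z / hz O z, hy O z / hz O z⟩

/-- The Euclidean height function in the direction `ω`. -/
noncomputable def height (ω : ℝ) (k : ℂ) : ℝ := k.re * cos ω + k.im * sin ω

lemma height_klein (O : ℍ) (ω : ℝ) (z : ℍ) : height ω (klein O z) = pc O ω z / hz O z := by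
  simp only [height, klein, pc]
  ring

lemma height_klein_mem (O : ℍ) (ω : ℝ) (z : ℍ) : height ω (klein O z) ∈ Ioo (-1 : ℝ) 1 := by
  have h0 := hz_pos O z
  have h1 := one_add_qc_sq O ω z
  have h2 : |pc O ω z| < hz O z := abs_lt_of_sq_lt_sq (by nlinarith [sq_nonneg (qc O ω z)]) h0.le
  rw [height_klein, mem_Ioo, lt_div_iff₀ h0, div_lt_one h0]
  constructor <;> linarith [abs_lt.1 h2]

/-- Projection to the axis keeps the Klein height, and the axis point at signed distance `r` has
height `tanh r`. So `lev` is an increasing function of a linear one, and order questions about `lev`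
become affine. -/
lemma lev_eq_sinh_artanh (O : ℍ) (ω : ℝ) (z : ℍ) :
    lev O ω z = sinh (artanh (height ω (klein O z))) := by
  have h0 := hz_pos O z
  rw [sinh_artanh (height_klein_mem O ω z), height_klein, lev, one_add_qc_sq]
  have : 1 - (pc O ω z / hz O z) ^ 2 = (hz O z ^ 2 - pc O ω z ^ 2) / hz O z ^ 2 := by
    field_simp
  rw [this, Real.sqrt_div' _ (sq_nonneg _), Real.sqrt_sq h0.le]
  field_simp

lemma lev_lt_lev_iff {O : ℍ} {ω : ℝ} {z w : ℍ} :
    lev O ω z < lev O ω w ↔ height ω (klein O z) < height ω (klein O w) := by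
  rw [lev_eq_sinh_artanh, lev_eq_sinh_artanh, sinh_lt_sinh,
    artanh_lt_artanh_iff (height_klein_mem O ω z) (height_klein_mem O ω w)]

lemma lev_le_lev_iff {O : ℍ} {ω : ℝ} {z w : ℍ} :
    lev O ω z ≤ lev O ω w ↔ height ω (klein O z) ≤ height ω (klein O w) := by
  rw [← not_lt, lev_lt_lev_iff, not_lt]

lemma lev_eq_lev_iff {O : ℍ} {ω : ℝ} {z w : ℍ} :
    lev O ω z = lev O ω w ↔ height ω (klein O z) = height ω (klein O w) := by
  simp only [le_antisymm_iff, lev_le_lev_iff]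

lemma continuous_lev_uncurry (O : ℍ) : Continuous fun p : ℝ × ℍ => lev O p.1 p.2 := by
  have h1 := continuous_hx O
  have h2 := continuous_hy O
  unfold lev pc qc
  refine Continuous.div (by fun_prop) (by fun_prop) fun p => ?_
  positivity

lemma continuous_lev_left (O z : ℍ) : Continuous fun ω => lev O ω z :=
  (continuous_lev_uncurry O).comp (continuous_id.prodMk continuous_const)

lemma continuous_lev (O : ℍ) (ω : ℝ) : Continuous (lev O ω) :=
  (continuous_lev_uncurry O).comp (continuous_const.prodMk continuous_id)

lemma lev_add_pi (O : ℍ) (ω : ℝ) (z : ℍ) : lev O (ω + π) z = - lev O ω z := by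
  simp only [lev, pc, qc, cos_add_pi, sin_add_pi]
  rw [show (hx O z * -sin ω - hy O z * -cos ω) ^ 2 = (hx O z * sin ω - hy O z * cos ω) ^ 2 by ring]
  ring

lemma lev_add_two_pi (O : ℍ) (ω : ℝ) (z : ℍ) : lev O (ω + 2 * π) z = lev O ω z := by
  rw [two_mul, ← add_assoc, lev_add_pi, lev_add_pi, neg_neg]

/-- Rotating the direction turns `qc` into `pc`, and the derivative of arsinh supplies exactly the
denominator of `lev`. -/
lemma hasDerivAt_arsinh_qc (O z : ℍ) (ω : ℝ) :
    HasDerivAt (fun ω => arsinh (qc O ω z)) (lev O ω z) ω := by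
  have h : HasDerivAt (fun ω => qc O ω z) (pc O ω z) ω := by
    have := ((hasDerivAt_sin ω).const_mul (hx O z)).sub ((hasDerivAt_cos ω).const_mul (hy O z))
    convert! this using 1
    rw [pc]; ring
  convert! h.arsinh using 1
  rw [lev, smul_eq_mul, div_eq_inv_mul]

/-! ### The hyperbolic distance as an integral over directions -/

lemma exists_height_eq_cos (k : ℂ) : ∃ α ρ : ℝ, 0 ≤ ρ ∧ ∀ ω, height ω k = ρ * cos (ω - α) := by
  refine ⟨Complex.arg k, ‖k‖, norm_nonneg _, fun ω => ?_⟩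
  rw [height, cos_sub]
  rw [← Complex.norm_mul_cos_arg k, ← Complex.norm_mul_sin_arg k]
  simp only [Complex.norm_mul_cos_arg, Complex.norm_mul_sin_arg]
  linear_combination (- cos ω) * (Complex.norm_mul_cos_arg k) -
    sin ω * (Complex.norm_mul_sin_arg k)

/-- At equal heights the two points lie on one perpendicular to the axis, and arsinh of `qc` is an
arc length parameter on it. -/
lemma cosh_arsinh_qc_sub {O : ℍ} {β : ℝ} {z w : ℍ}
    (h : height β (klein O z) = height β (klein O w)) :
    cosh (arsinh (qc O β z) - arsinh (qc O β w)) = cosh (dist z w) := by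
  have hzz := hz_pos O z
  have hzw := hz_pos O w
  rw [cosh_sub, cosh_arsinh, cosh_arsinh, sinh_arsinh, sinh_arsinh, cosh_dist_eq_pc_qc O β,
    ← Real.sqrt_mul (by positivity), one_add_qc_sq, one_add_qc_sq]
  have hk := height_klein_mem O β w
  have e1 : pc O β z = height β (klein O w) * hz O z := by
    rw [← h, height_klein]; field_simp
  have e2 : pc O β w = height β (klein O w) * hz O w := by
    rw [height_klein]; field_simp
  set t := height β (klein O w)
  rw [e1, e2]
  have : (hz O z ^ 2 - (t * hz O z) ^ 2) * (hz O w ^ 2 - (t * hz O w) ^ 2) =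
      ((1 - t ^ 2) * hz O z * hz O w) ^ 2 := by ring
  rw [this, Real.sqrt_sq]
  · ring
  · have : 0 ≤ 1 - t ^ 2 := by nlinarith [hk.1, hk.2]
    positivity

/-- The heights differ by `ρ * cos (ω - α)`, so `g` is nonnegative on the half-turn about `α`. There
the primitive `G` has boundary values plus and minus the distance; the opposite half-turn
contributes the same, as `g` changes sign under `ω + π`. -/
theorem integral_abs_lev_sub (O z w : ℍ) :
    ∫ ω in (0 : ℝ)..(2 * π), |lev O ω z - lev O ω w| = 4 * dist z w := by
  obtain ⟨α, ρ, hρ, hα⟩ := exists_height_eq_cos (klein O z - klein O w)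
  have hsub (ω : ℝ) : height ω (klein O z) - height ω (klein O w) = ρ * cos (ω - α) := by
    rw [← hα]; simp only [height, Complex.sub_re, Complex.sub_im]; ring
  set g : ℝ → ℝ := fun ω => lev O ω z - lev O ω w with hg
  have hgc : Continuous g := (continuous_lev_left O z).sub (continuous_lev_left O w)
  have hgπ (ω : ℝ) : g (ω + π) = - g ω := by simp only [hg, lev_add_pi]; ring
  have hper : Function.Periodic (fun ω => |g ω|) (2 * π) := fun ω => by
    simp only [hg, lev_add_two_pi]
  have hpos : ∀ ω ∈ Icc (α - π / 2) (α + π / 2), 0 ≤ g ω := fun ω hω => by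
    have : 0 ≤ cos (ω - α) := cos_nonneg_of_mem_Icc ⟨by linarith [hω.1], by linarith [hω.2]⟩
    have h := hsub ω
    exact sub_nonneg.2 (lev_le_lev_iff.2 (by nlinarith))
  have hint : ∀ a b, IntervalIntegrable (fun ω => |g ω|) volume a b := fun a b =>
    hgc.abs.intervalIntegrable a b
  have h1 : ∫ ω in (0 : ℝ)..(2 * π), |g ω| = ∫ ω in (α - π / 2)..(α - π / 2 + 2 * π), |g ω| := by
    have := hper.intervalIntegral_add_eq 0 (α - π / 2)
    rwa [zero_add] at this
  have h2 : ∫ ω in (α + π / 2)..(α - π / 2 + 2 * π), |g ω| =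
      ∫ ω in (α - π / 2)..(α + π / 2), |g ω| := by
    have := intervalIntegral.integral_comp_add_right (a := α - π / 2) (b := α + π / 2)
      (fun ω => |g ω|) π
    rw [show α + π / 2 = α - π / 2 + π by ring,
      show α - π / 2 + 2 * π = α - π / 2 + π + π by ring]
    rw [show α + π / 2 = α - π / 2 + π by ring] at this
    rw [← this]
    simp only [hgπ, abs_neg]
  set G : ℝ → ℝ := fun ω => arsinh (qc O ω z) - arsinh (qc O ω w) with hG
  have h3 : ∫ ω in (α - π / 2)..(α + π / 2), |g ω| = G (α + π / 2) - G (α - π / 2) := by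
    rw [intervalIntegral.integral_congr (g := g)]
    · exact intervalIntegral.integral_eq_sub_of_hasDerivAt
        (fun ω _ => (hasDerivAt_arsinh_qc O z ω).sub (hasDerivAt_arsinh_qc O w ω))
        (hgc.intervalIntegrable _ _)
    · intro ω hω
      rw [uIcc_of_le (by linarith [pi_pos])] at hω
      exact abs_of_nonneg (hpos ω hω)
  have hqc (v : ℍ) : qc O (α + π / 2) v = - qc O (α - π / 2) v := by
    rw [show α + π / 2 = α - π / 2 + π by ring, qc, qc, cos_add_pi, sin_add_pi]; ring
  have h4 : G (α - π / 2) = - G (α + π / 2) := by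
    simp only [hG, hqc, arsinh_neg]; ring
  have h5 : 0 ≤ ∫ ω in (α - π / 2)..(α + π / 2), |g ω| :=
    intervalIntegral.integral_nonneg (by linarith [pi_pos]) fun ω _ => abs_nonneg _
  -- In the direction `α + π / 2` the two heights agree, which gives the value up to sign;
  -- nonnegativity of the integral fixes the sign.
  have h6 : G (α + π / 2) = dist z w := by
    have hc : cosh (G (α + π / 2)) = cosh (dist z w) := by
      apply cosh_arsinh_qc_sub
      have := hsub (α + π / 2)
      rw [add_sub_cancel_left, cos_pi_div_two] at this
      linarith
    have h7 := cosh_le_cosh.1 hc.le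
    have h8 := cosh_le_cosh.1 hc.ge
    rw [abs_of_nonneg (by linarith : 0 ≤ G (α + π / 2)), abs_of_nonneg dist_nonneg] at h7 h8
    linarith
  rw [h1, ← intervalIntegral.integral_add_adjacent_intervals (hint _ (α + π / 2)) (hint _ _), h2,
    h3, h4, h6]
  ring

/-! ### Segments in the Klein model -/

theorem integral_abs_lev_sub_add_two_pi (O z w : ℍ) (a : ℝ) :
    ∫ ω in a..(a + 2 * π), |lev O ω z - lev O ω w| = 4 * dist z w := by
  have hper : Function.Periodic (fun ω => |lev O ω z - lev O ω w|) (2 * π) := fun ω => by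
    simp only [lev_add_two_pi]
  rw [hper.intervalIntegral_add_eq a 0, zero_add, integral_abs_lev_sub]

lemma continuous_abs_lev_sub (O z w : ℍ) : Continuous fun ω => |lev O ω z - lev O ω w| :=
  ((continuous_lev_left O z).sub (continuous_lev_left O w)).abs

/-- The triangle inequality for the real numbers `lev` is strict in the direction `ω`, so by
continuity it stays strict after integration. Consequently a segment does not leave an open
half-plane that contains its ends. -/
lemma dist_lt_of_lev_lt {O x y p : ℍ} {ω : ℝ} (hx : lev O ω p < lev O ω x)
    (hy : lev O ω p < lev O ω y) : dist x y < dist x p + dist p y := by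
  have hi (z w : ℍ) : IntervalIntegrable (fun ω => |lev O ω z - lev O ω w|) volume ω (ω + 2 * π) :=
    (continuous_abs_lev_sub O z w).intervalIntegrable _ _
  have h : 0 < ∫ η in ω..(ω + 2 * π), (|lev O η x - lev O η p| + |lev O η p - lev O η y| -
      |lev O η x - lev O η y|) := by
    refine intervalIntegral.integral_pos (by linarith [pi_pos]) ?_ ?_ ⟨ω, ?_, ?_⟩
    · exact (((continuous_abs_lev_sub O x p).add (continuous_abs_lev_sub O p y)).sub
        (continuous_abs_lev_sub O x y)).continuousOn
    · intro η _
      linarith [abs_sub_le (lev O η x) (lev O η p) (lev O η y)]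
    · exact left_mem_Icc.2 (by linarith [pi_pos])
    · rw [abs_of_pos (sub_pos.2 hx), abs_of_neg (sub_neg.2 hy), sub_pos, abs_lt]
      constructor <;> linarith
  rw [intervalIntegral.integral_sub ((hi x p).add (hi p y)) (hi x y),
    intervalIntegral.integral_add (hi x p) (hi p y)] at h
  simp only [integral_abs_lev_sub_add_two_pi] at h
  linarith

lemma height_combo (ω a b : ℝ) (k l : ℂ) :
    height ω (a • k + b • l) = a * height ω k + b * height ω l := by
  simp only [height, Complex.add_re, Complex.add_im, Complex.smul_re, Complex.smul_im, smul_eq_mul]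
  ring

/-- On a Klein chord `lev` is between its end values in every direction, so the triangle inequality
is an equality for each `ω` and hence for the integrals. -/
lemma dist_add_dist_of_klein_eq {O x y z : ℍ} {a b : ℝ} (ha : 0 ≤ a) (hb : 0 ≤ b)
    (hab : a + b = 1) (h : klein O z = a • klein O x + b • klein O y) :
    dist x z + dist z y = dist x y := by
  have hi (z w : ℍ) : IntervalIntegrable (fun ω => |lev O ω z - lev O ω w|) volume 0 (2 * π) :=
    (continuous_abs_lev_sub O z w).intervalIntegrable _ _
  have key (ω : ℝ) : |lev O ω x - lev O ω z| + |lev O ω z - lev O ω y| =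
      |lev O ω x - lev O ω y| := by
    have hh := height_combo ω a b (klein O x) (klein O y)
    rw [← h] at hh
    obtain rfl : a = 1 - b := by linarith
    rcases le_total (height ω (klein O x)) (height ω (klein O y)) with hl | hl
    · have h1 : lev O ω x ≤ lev O ω z := lev_le_lev_iff.2 (by nlinarith)
      have h2 : lev O ω z ≤ lev O ω y := lev_le_lev_iff.2 (by nlinarith)
      rw [abs_of_nonpos (by linarith), abs_of_nonpos (by linarith), abs_of_nonpos (by linarith)]
      ring
    · have h1 : lev O ω z ≤ lev O ω x := lev_le_lev_iff.2 (by nlinarith)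
      have h2 : lev O ω y ≤ lev O ω z := lev_le_lev_iff.2 (by nlinarith)
      rw [abs_of_nonneg (by linarith), abs_of_nonneg (by linarith), abs_of_nonneg (by linarith)]
      ring
  have := intervalIntegral.integral_add (hi x z) (hi z y)
  simp only [key, integral_abs_lev_sub] at this
  linarith

/-! ### The Klein model as a homeomorphism onto the open unit disc -/

lemma continuous_klein (O : ℍ) : Continuous (klein O) := by
  have h0 : ∀ z, hz O z ≠ 0 := fun z => (hz_pos O z).ne'
  exact Complex.equivRealProdCLM.symm.continuous.comp
    (((continuous_hx O).div (continuous_hz O) h0).prodMk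
      ((continuous_hy O).div (continuous_hz O) h0))

lemma one_sub_norm_klein_sq (O z : ℍ) : 1 - ‖klein O z‖ ^ 2 = 1 / hz O z ^ 2 := by
  have h0 := (hz_pos O z).ne'
  have h1 := hz_sq O z
  rw [Complex.sq_norm, Complex.normSq_apply, klein]
  field_simp
  linarith

lemma norm_klein_lt_one (O z : ℍ) : ‖klein O z‖ < 1 := by
  have h0 := hz_pos O z
  have h1 := one_sub_norm_klein_sq O z
  have h2 : 0 < 1 / hz O z ^ 2 := by positivity
  nlinarith [norm_nonneg (klein O z)]

/-- The inverse of the Klein model. -/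
noncomputable def kleinInv (O : ℍ) (k : ℂ) : ℍ :=
  ofHyp O (k.re / √(1 - ‖k‖ ^ 2)) (k.im / √(1 - ‖k‖ ^ 2))

lemma klein_kleinInv (O : ℍ) {k : ℂ} (hk : ‖k‖ < 1) : klein O (kleinInv O k) = k := by
  have h1 : 0 < 1 - ‖k‖ ^ 2 := by nlinarith [norm_nonneg k]
  have h2 : √(1 + (k.re / √(1 - ‖k‖ ^ 2)) ^ 2 + (k.im / √(1 - ‖k‖ ^ 2)) ^ 2) =
      1 / √(1 - ‖k‖ ^ 2) := by
    rw [Real.sqrt_eq_iff_mul_self_eq (by positivity) (by positivity)]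
    have hs := Real.sq_sqrt h1.le
    have hs0 := (Real.sqrt_pos.2 h1).ne'
    have hn := Complex.sq_norm k
    rw [Complex.normSq_apply] at hn
    set s := √(1 - ‖k‖ ^ 2)
    field_simp
    linarith
  have hs0 := (Real.sqrt_pos.2 h1).ne'
  apply Complex.ext
  · simp only [klein, kleinInv, hx_ofHyp, hz_ofHyp, h2]
    field_simp
  · simp only [klein, kleinInv, hy_ofHyp, hz_ofHyp, h2]
    field_simp

lemma klein_injective (O : ℍ) : Function.Injective (klein O) := by
  intro z w h
  have h1 := one_sub_norm_klein_sq O z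
  rw [h, one_sub_norm_klein_sq O w] at h1
  have hz0 := hz_pos O z
  have hw0 := hz_pos O w
  have h2 : hz O z = hz O w := by
    have : hz O z ^ 2 = hz O w ^ 2 := by
      field_simp at h1
      exact h1
    exact (pow_left_inj₀ hz0.le hw0.le two_ne_zero).1 this
  have hre := congrArg Complex.re h
  have him := congrArg Complex.im h
  simp only [klein, h2] at hre him
  exact ext_of_hyp ((div_left_inj' hw0.ne').1 hre) ((div_left_inj' hw0.ne').1 him)

lemma kleinInv_klein (O z : ℍ) : kleinInv O (klein O z) = z :=
  klein_injective O (klein_kleinInv O (norm_klein_lt_one O z))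

lemma continuousOn_kleinInv (O : ℍ) : ContinuousOn (kleinInv O) (Metric.ball 0 1) := by
  have h : ContinuousOn (fun k : ℂ => (k.re / √(1 - ‖k‖ ^ 2), k.im / √(1 - ‖k‖ ^ 2)))
      (Metric.ball 0 1) := by
    have h0 : ∀ k ∈ Metric.ball (0 : ℂ) 1, √(1 - ‖k‖ ^ 2) ≠ 0 := fun k hk => by
      rw [mem_ball_zero_iff] at hk
      exact (Real.sqrt_pos.2 (by nlinarith [norm_nonneg k])).ne'
    have h1 : Continuous fun k : ℂ => √(1 - ‖k‖ ^ 2) := by fun_prop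
    exact (Complex.continuous_re.continuousOn.div h1.continuousOn h0).prodMk
      (Complex.continuous_im.continuousOn.div h1.continuousOn h0)
  exact (continuous_ofHyp O).comp_continuousOn h

lemma exists_klein_combo (O x y : ℍ) {a b : ℝ} (ha : 0 ≤ a) (hb : 0 ≤ b) (hab : a + b = 1) :
    ∃ z, klein O z = a • klein O x + b • klein O y ∧ dist x z + dist z y = dist x y := by
  have hk : ‖a • klein O x + b • klein O y‖ < 1 := by
    have := convex_ball (0 : ℂ) 1 (mem_ball_zero_iff.2 (norm_klein_lt_one O x))
      (mem_ball_zero_iff.2 (norm_klein_lt_one O y)) ha hb hab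
    exact mem_ball_zero_iff.1 this
  exact ⟨_, klein_kleinInv O hk, dist_add_dist_of_klein_eq ha hb hab (klein_kleinInv O hk)⟩

lemma GeodConvex.convex_klein {K : Set ℍ} (hK : GeodConvex K) (O : ℍ) :
    Convex ℝ (klein O '' K) := by
  rintro _ ⟨x, hx, rfl⟩ _ ⟨y, hy, rfl⟩ a b ha hb hab
  obtain ⟨z, hz, hd⟩ := exists_klein_combo O x y ha hb hab
  exact ⟨z, hK x hx y hy z hd, hz⟩

lemma klein_image_interior (O : ℍ) (K : Set ℍ) :
    klein O '' interior K = interior (klein O '' K) := by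
  apply Subset.antisymm
  · apply interior_maximal (image_mono interior_subset)
    have : klein O '' interior K = Metric.ball 0 1 ∩ kleinInv O ⁻¹' interior K := by
      ext k
      constructor
      · rintro ⟨z, hz, rfl⟩
        exact ⟨mem_ball_zero_iff.2 (norm_klein_lt_one O z), by rwa [mem_preimage, kleinInv_klein]⟩
      · rintro ⟨hk, hk'⟩
        exact ⟨_, hk', klein_kleinInv O (mem_ball_zero_iff.1 hk)⟩
    rw [this]
    exact (continuousOn_kleinInv O).isOpen_inter_preimage Metric.isOpen_ball isOpen_interior
  · intro k hk
    obtain ⟨z, hz, rfl⟩ := interior_subset hk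
    refine ⟨z, ?_, rfl⟩
    have h : klein O ⁻¹' interior (klein O '' K) ⊆ K := fun w hw => by
      obtain ⟨v, hv, hvw⟩ := interior_subset hw
      rwa [← klein_injective O hvw]
    exact interior_maximal h (isOpen_interior.preimage (continuous_klein O)) hk

lemma klein_image_frontier (O : ℍ) {K : Set ℍ} (hK : IsCompact K) :
    klein O '' frontier K = frontier (klein O '' K) := by
  rw [hK.isClosed.frontier_eq, (hK.image (continuous_klein O)).isClosed.frontier_eq,
    image_sdiff (klein_injective O), klein_image_interior]

/-! ### Support lines -/

lemma pc_polar (O : ℍ) (ω t : ℝ) : pc O ω (polar O ω t) = sinh t ∧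
    qc O ω (polar O ω t) = 0 ∧ hz O (polar O ω t) = cosh t := by
  have hd := (cosh_sub_sinh_mul_sin_pos ω t).ne'
  have hO := O.im_pos.ne'
  have hsc := sin_sq_add_cos_sq ω
  have hch := cosh_sq t
  have h1 : hx O (polar O ω t) = sinh t * cos ω := by
    change (O.re + O.im * (sinh t * cos ω / (cosh t - sinh t * sin ω)) - O.re) /
      (O.im / (cosh t - sinh t * sin ω)) = _
    field_simp
    ring
  have h2 : hz O (polar O ω t) = cosh t := by
    change ((O.re + O.im * (sinh t * cos ω / (cosh t - sinh t * sin ω)) - O.re) ^ 2 +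
      (O.im / (cosh t - sinh t * sin ω)) ^ 2 + O.im ^ 2) /
      (2 * (O.im / (cosh t - sinh t * sin ω)) * O.im) = _
    field_simp
    linear_combination (O.im ^ 2) * (sinh t ^ 2 * hsc - hch)
  have h3 : hy O (polar O ω t) = sinh t * sin ω := by
    rw [hy, h2]
    change cosh t - O.im / (O.im / (cosh t - sinh t * sin ω)) = _
    field_simp
    ring
  refine ⟨?_, ?_, h2⟩
  · rw [pc, h1, h3]; linear_combination sinh t * hsc
  · rw [qc, h1, h3]; ring

lemma lev_polar (O : ℍ) (ω t : ℝ) : lev O ω (polar O ω t) = sinh t := by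
  obtain ⟨h1, h2, -⟩ := pc_polar O ω t
  rw [lev, h1, h2]
  simp

lemma cosh_dist_polar (O : ℍ) (ω t : ℝ) (z : ℍ) :
    cosh (dist (polar O ω t) z) = cosh t * hz O z - sinh t * pc O ω z := by
  obtain ⟨h1, h2, h3⟩ := pc_polar O ω t
  rw [cosh_dist_eq_pc_qc O ω, h1, h2, h3]
  ring

lemma pc_eq_lev_mul (O : ℍ) (ω : ℝ) (z : ℍ) : pc O ω z = lev O ω z * √(1 + qc O ω z ^ 2) := by
  have : 0 < √(1 + qc O ω z ^ 2) := by positivity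
  rw [lev]
  field_simp

lemma hz_eq (O : ℍ) (ω : ℝ) (z : ℍ) :
    hz O z = √(1 + lev O ω z ^ 2) * √(1 + qc O ω z ^ 2) := by
  rw [← Real.sqrt_mul (by positivity), eq_comm, Real.sqrt_eq_iff_mul_self_eq (by positivity)
    (hz_pos O z).le]
  have h1 := one_add_qc_sq O ω z
  have h2 := pc_eq_lev_mul O ω z
  have h3 : √(1 + qc O ω z ^ 2) ^ 2 = 1 + qc O ω z ^ 2 := Real.sq_sqrt (by positivity)
  rw [h2] at h1
  linear_combination h1 - lev O ω z ^ 2 * h3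

lemma isGeodesicLine_lev (O : ℍ) (ω s : ℝ) : IsGeodesicLine {z | lev O ω z = sinh s} := by
  -- The arc length parametrisation of the perpendicular at signed distance `s`, starting at its
  -- foot.
  choose γ h1 h2 using fun τ => exists_pc_qc O ω (sinh s * cosh τ) (sinh τ)
  have hc (τ : ℝ) : √(1 + qc O ω (γ τ) ^ 2) = cosh τ := by
    rw [h2, add_comm, ← cosh_sq, Real.sqrt_sq (cosh_pos τ).le]
  have hl (τ : ℝ) : lev O ω (γ τ) = sinh s := by
    have := cosh_pos τ
    rw [lev, hc, h1]
    field_simp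
  have hZ (τ : ℝ) : hz O (γ τ) = cosh s * cosh τ := by
    rw [hz_eq O ω, hl, hc, add_comm, ← cosh_sq, Real.sqrt_sq (cosh_pos s).le]
  refine ⟨γ, Isometry.of_dist_eq fun a b => ?_, ?_⟩
  · have h : cosh (dist (γ a) (γ b)) = cosh (dist a b) := by
      rw [cosh_dist_eq_pc_qc O ω, hZ, hZ, h1, h1, h2, h2, Real.dist_eq, cosh_abs, cosh_sub]
      linear_combination (cosh a * cosh b) * cosh_sq s
    have h7 := cosh_le_cosh.1 h.le
    have h8 := cosh_le_cosh.1 h.ge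
    simp only [abs_of_nonneg dist_nonneg] at h7 h8
    exact le_antisymm h7 h8
  · ext z
    constructor
    · rintro ⟨τ, rfl⟩
      exact hl τ
    · intro hz
      refine ⟨arsinh (qc O ω z), ext_of_pc_qc (O := O) ω ?_ ?_⟩
      · rw [h1, cosh_arsinh, pc_eq_lev_mul O ω z, hz]
      · rw [h2, sinh_arsinh]

lemma isSupportLineAt_lev {K : Set ℍ} {O z₀ : ℍ} {ω s : ℝ} (hz₀ : z₀ ∈ K)
    (hs : lev O ω z₀ = sinh s) (hmax : ∀ z ∈ K, lev O ω z ≤ sinh s) :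
    IsSupportLineAt K O ω s {z | lev O ω z = sinh s} where
  isGeodesicLine := isGeodesicLine_lev O ω s
  foot_mem := lev_polar O ω s
  closest t p hp := by
    have h : cosh (dist (polar O ω t) (polar O ω s)) ≤ cosh (dist (polar O ω t) p) := by
      obtain ⟨h1, -, h3⟩ := pc_polar O ω s
      rw [cosh_dist_polar, cosh_dist_polar, h1, h3, pc_eq_lev_mul, hz_eq O ω p,
        show lev O ω p = sinh s from hp, add_comm, ← cosh_sq, Real.sqrt_sq (cosh_pos s).le]
      have h4 : 1 ≤ √(1 + qc O ω p ^ 2) := by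
        rw [Real.one_le_sqrt]
        nlinarith [sq_nonneg (qc O ω p)]
      have h5 := cosh_pos (t - s)
      rw [cosh_sub] at h5
      nlinarith
    have := cosh_le_cosh.1 h
    simpa only [abs_of_nonneg dist_nonneg] using this
  touches := ⟨z₀, hs, hz₀⟩
  oneSided z hz t ht := by
    have h1 : height ω (klein O z) ≤ height ω (klein O (polar O ω s)) := by
      rw [← lev_le_lev_iff, lev_polar]
      exact hmax z hz
    have h2 : height ω (klein O (polar O ω s)) < height ω (klein O (polar O ω t)) := by
      rw [← lev_lt_lev_iff, lev_polar, lev_polar]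
      exact sinh_lt_sinh.2 ht
    set A := height ω (klein O z)
    set B := height ω (klein O (polar O ω s)) with hB
    set C := height ω (klein O (polar O ω t))
    have hCA : 0 < C - A := by linarith
    -- The weights are those for which the chord has height `B`, the height of the candidate line.
    obtain ⟨p, hp, hd⟩ := exists_klein_combo O z (polar O ω t) (a := (C - B) / (C - A))
      (b := (B - A) / (C - A)) (div_nonneg (by linarith) hCA.le) (div_nonneg (by linarith) hCA.le)
      (by field_simp; ring)
    refine ⟨p, ?_, hd⟩
    rw [mem_ofPred_eq, ← lev_polar O ω s, lev_eq_lev_iff, hp, height_combo]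
    change (C - B) / (C - A) * A + (B - A) / (C - A) * C = B
    field_simp
    ring

/-! ### Uniqueness of the support line -/

/-- A null vector that is Lorentz orthogonal to a timelike one vanishes: Cauchy–Schwarz bounds `(Z *
Zw) ^ 2` by `(Z ^ 2 - 1) * Zw ^ 2`. -/
lemma lorentz_null_eq_zero {Z p q Zw pw qw : ℝ} (h : Z ^ 2 = 1 + p ^ 2 + q ^ 2)
    (h0 : Zw ^ 2 = pw ^ 2 + qw ^ 2) (h1 : Z * Zw = p * pw + q * qw) :
    Zw = 0 ∧ pw = 0 ∧ qw = 0 := by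
  have h2 : Zw ^ 2 ≤ 0 := by
    have e : (Z * Zw) ^ 2 = (p * pw + q * qw) ^ 2 := by rw [h1]
    nlinarith [sq_nonneg (p * qw - q * pw)]
  have h3 : Zw = 0 := by nlinarith [sq_nonneg Zw]
  rw [h3] at h0
  exact ⟨h3, by nlinarith [sq_nonneg pw, sq_nonneg qw], by nlinarith [sq_nonneg pw, sq_nonneg qw]⟩

/-- The mutual distances of the points at `τ₀`, `τ₀ + τ`, `τ₀ + 1` show that the defect in the
expected linear relation of hyperboloid vectors is null and orthogonal to the point at `τ₀`, hence
zero. So a linear functional along an isometric line is determined by two values. -/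
lemma isometry_line_combo (O : ℍ) (ω : ℝ) {γ : ℝ → ℍ} (hγ : Isometry γ) (τ₀ τ : ℝ) :
    sinh 1 * hz O (γ (τ₀ + τ)) =
      sinh (1 - τ) * hz O (γ τ₀) + sinh τ * hz O (γ (τ₀ + 1)) ∧
    sinh 1 * pc O ω (γ (τ₀ + τ)) =
      sinh (1 - τ) * pc O ω (γ τ₀) + sinh τ * pc O ω (γ (τ₀ + 1)) := by
  have hd (a b : ℝ) : cosh (a - b) = hz O (γ a) * hz O (γ b) - pc O ω (γ a) * pc O ω (γ b) -
      qc O ω (γ a) * qc O ω (γ b) := by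
    rw [← cosh_dist_eq_pc_qc O, hγ.dist_eq, Real.dist_eq, cosh_abs]
  have hA := hd τ₀ τ₀
  have hB := hd (τ₀ + 1) (τ₀ + 1)
  have hP := hd (τ₀ + τ) (τ₀ + τ)
  have hPA := hd (τ₀ + τ) τ₀
  have hBA := hd (τ₀ + 1) τ₀
  have hBP := hd (τ₀ + 1) (τ₀ + τ)
  rw [sub_self, cosh_zero] at hA hB hP
  rw [add_sub_cancel_left] at hPA hBA
  rw [add_sub_add_left_eq_sub] at hBP
  rw [cosh_sub] at hBP
  have hs : sinh (1 - τ) = sinh 1 * cosh τ - cosh 1 * sinh τ := sinh_sub 1 τ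
  have c1 := cosh_sq 1
  have ct := cosh_sq τ
  rw [hs]
  generalize hz O (γ τ₀) = ZA at *
  generalize hz O (γ (τ₀ + 1)) = ZB at *
  generalize hz O (γ (τ₀ + τ)) = ZP at *
  generalize pc O ω (γ τ₀) = pA at *
  generalize pc O ω (γ (τ₀ + 1)) = pB at *
  generalize pc O ω (γ (τ₀ + τ)) = pP at *
  generalize qc O ω (γ τ₀) = qA at *
  generalize qc O ω (γ (τ₀ + 1)) = qB at *
  generalize qc O ω (γ (τ₀ + τ)) = qP at *
  generalize cosh 1 = C at *
  generalize cosh τ = c at *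
  generalize sinh 1 = S at *
  generalize sinh τ = s at *
  clear hd hs
  have key := lorentz_null_eq_zero (Z := ZA) (p := pA) (q := qA)
    (Zw := S * ZP - ((S * c - C * s) * ZA + s * ZB))
    (pw := S * pP - ((S * c - C * s) * pA + s * pB))
    (qw := S * qP - ((S * c - C * s) * qA + s * qB)) (by linear_combination (-1) * hA)
    (by
      linear_combination (-S ^ 2) * hP - (S * c - C * s) ^ 2 * hA - s ^ 2 * hB +
        2 * S * (S * c - C * s) * hPA + 2 * S * s * hBP - 2 * (S * c - C * s) * s * hBA -
        S ^ 2 * ct - s ^ 2 * c1)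
    (by
      linear_combination (-S) * hPA + (S * c - C * s) * hA + s * hBA)
  exact ⟨by linarith [key.1], by linarith [key.2.1]⟩

/-- The functional `N` vanishes exactly on the level set. Along the line it is a multiple of `sinh
τ`, of first order in `τ`, whereas minimality of the foot bounds it by a multiple of `cosh τ - 1`,
of second order; so the multiple is zero. -/
lemma IsSupportLineAt.subset_lev {K L : Set ℍ} {O : ℍ} {ω s : ℝ}
    (h : IsSupportLineAt K O ω s L) : L ⊆ {z | lev O ω z = sinh s} := by
  obtain ⟨γ, hγ, rfl⟩ := h.isGeodesicLine
  obtain ⟨τ₀, hτ₀⟩ := h.foot_mem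
  obtain ⟨hp, hq, hZ⟩ := pc_polar O ω s
  set N : ℝ → ℝ := fun τ => cosh s * pc O ω (γ (τ₀ + τ)) - sinh s * hz O (γ (τ₀ + τ)) with hN
  have hlin (τ : ℝ) : sinh 1 * N τ = sinh τ * N 1 := by
    obtain ⟨e1, e2⟩ := isometry_line_combo O ω hγ τ₀ τ
    rw [hτ₀] at e1 e2
    simp only [hN]
    rw [hZ] at e1
    rw [hp] at e2
    linear_combination cosh s * e2 - sinh s * e1
  have hM (τ : ℝ) : cosh s * hz O (γ (τ₀ + τ)) - sinh s * pc O ω (γ (τ₀ + τ)) = cosh τ := by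
    rw [← cosh_dist_polar, ← hτ₀, hγ.dist_eq, Real.dist_eq, cosh_abs, sub_add_cancel_left, cosh_neg]
  have hbd (τ u : ℝ) : cosh u ≤ cosh u * cosh τ - sinh u * N τ := by
    have h1 := h.closest (s + u) (γ (τ₀ + τ)) (mem_range_self _)
    have h2 : cosh (dist (polar O ω (s + u)) (polar O ω s)) ≤
        cosh (dist (polar O ω (s + u)) (γ (τ₀ + τ))) := by
      rw [cosh_le_cosh, abs_of_nonneg dist_nonneg, abs_of_nonneg dist_nonneg]
      exact h1
    rw [cosh_dist_polar, cosh_dist_polar, hp, hZ, cosh_add, sinh_add] at h2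
    rw [← hM τ]
    simp only [hN]
    have c1 := cosh_sq s
    have e : (cosh s * cosh u + sinh s * sinh u) * cosh s -
        (sinh s * cosh u + cosh s * sinh u) * sinh s = cosh u := by
      linear_combination cosh u * c1
    rw [e] at h2
    linarith
  have hN1 : N 1 = 0 := by
    by_contra hne
    have hpos : 0 < |N 1| := abs_pos.2 hne
    have hC := cosh_pos 1
    have key : ∀ ε > 0, |N 1| ≤ cosh 1 * ε / 2 := by
      intro ε hε
      -- Testing against axis points on both sides of the foot bounds `N` from above and below.
      have h1 := hbd (arsinh ε) 1
      have h2 := hbd (arsinh ε) (-1)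
      rw [cosh_neg, sinh_neg] at h2
      have h3 := hlin (arsinh ε)
      rw [sinh_arsinh] at h3
      rw [cosh_arsinh] at h1 h2
      have h4 : √(1 + ε ^ 2) ≤ 1 + ε ^ 2 / 2 := by
        rw [Real.sqrt_le_left (by positivity)]
        nlinarith [sq_nonneg (ε ^ 2)]
      have h5 : |ε * N 1| ≤ cosh 1 * (ε ^ 2 / 2) := by
        rw [← h3, abs_le]
        constructor <;> nlinarith
      rw [abs_mul, abs_of_pos hε] at h5
      have : ε * |N 1| ≤ ε * (cosh 1 * ε / 2) := by linarith
      exact le_of_mul_le_mul_left this hε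
    -- This `ε` turns the bound into `|N 1| ≤ |N 1| / 2`.
    have := key (|N 1| / cosh 1) (by positivity)
    rw [mul_div_cancel₀ _ hC.ne'] at this
    linarith
  rintro _ ⟨τ, rfl⟩
  have h1 : N (τ - τ₀) = 0 := by
    have h2 := hlin (τ - τ₀)
    rw [hN1, mul_zero] at h2
    exact (mul_eq_zero.1 h2).resolve_left (sinh_pos_iff.2 one_pos).ne'
  simp only [hN, add_sub_cancel] at h1
  change lev O ω (γ τ) = sinh s
  rw [← lev_polar O ω s, lev_eq_lev_iff, height_klein, height_klein, hp, hZ]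
  have := hz_pos O (γ τ)
  have := cosh_pos s
  rw [div_eq_div_iff (by positivity) (by positivity)]
  linarith

/-- The support function of `K` in the direction `ω`, as a hyperbolic sine. -/
noncomputable def supp (K : Set ℍ) (O : ℍ) (ω : ℝ) : ℝ := sSup (lev O ω '' K)

lemma exists_lev_eq_supp {K : Set ℍ} (hK : IsCompact K) (hne : K.Nonempty) (O : ℍ) (ω : ℝ) :
    ∃ z ∈ K, lev O ω z = supp K O ω := by
  obtain ⟨z, hz, h⟩ := hK.exists_sSup_image_eq hne (continuous_lev O ω).continuousOn
  exact ⟨z, hz, h.symm⟩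

lemma lev_le_supp {K : Set ℍ} (hK : IsCompact K) (O : ℍ) (ω : ℝ) {z : ℍ} (hz : z ∈ K) :
    lev O ω z ≤ supp K O ω :=
  le_csSup (hK.image (continuous_lev O ω)).bddAbove (mem_image_of_mem _ hz)

lemma neg_supp_le_lev {K : Set ℍ} (hK : IsCompact K) (O : ℍ) (ω : ℝ) {z : ℍ} (hz : z ∈ K) :
    - supp K O (ω + π) ≤ lev O ω z := by
  have := lev_le_supp hK O (ω + π) hz
  rw [lev_add_pi] at this
  linarith

lemma continuous_supp {K : Set ℍ} (hK : IsCompact K) (O : ℍ) : Continuous (supp K O) :=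
  hK.continuous_sSup (f := fun ω z => lev O ω z) (continuous_lev_uncurry O)

lemma supp_add_two_pi (K : Set ℍ) (O : ℍ) : Function.Periodic (supp K O) (2 * π) := fun ω => by
  have : lev O (ω + 2 * π) = lev O ω := funext (lev_add_two_pi O ω)
  rw [supp, this, supp]

theorem exists_isSupportLineAt_iff {K : Set ℍ} (hK : IsCompact K) (hne : K.Nonempty) (O : ℍ)
    (ω s : ℝ) : (∃ L, IsSupportLineAt K O ω s L) ↔ s = arsinh (supp K O ω) := by
  constructor
  · rintro ⟨L, hL⟩
    have hsub := hL.subset_lev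
    obtain ⟨z₀, hz₀, hz₀K⟩ := hL.touches
    rw [eq_comm, ← arsinh_sinh s, arsinh_inj]
    apply le_antisymm
    · obtain ⟨z, hz, h⟩ := exists_lev_eq_supp hK hne O ω
      rw [← h]
      by_contra! hlt
      -- If `z` were strictly above the level of `L`, both ends of this segment would be, so it
      -- could not meet `L`.
      obtain ⟨p, hp, hd⟩ := hL.oneSided z hz (s + 1) (by linarith)
      have hps : lev O ω p = sinh s := hsub hp
      have := dist_lt_of_lev_lt (O := O) (ω := ω) (p := p) (x := z) (y := polar O ω (s + 1))
        (by rwa [hps]) (by rw [hps, lev_polar]; exact sinh_lt_sinh.2 (by linarith))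
      linarith
    · rw [← show lev O ω z₀ = sinh s from hsub hz₀]
      exact lev_le_supp hK O ω hz₀K
  · rintro rfl
    obtain ⟨z, hz, h⟩ := exists_lev_eq_supp hK hne O ω
    refine ⟨_, isSupportLineAt_lev hz ?_ ?_⟩
    · rw [sinh_arsinh, h]
    · rw [sinh_arsinh]
      exact fun w hw => lev_le_supp hK O ω hw

/-! ### Level lines and the boundary -/

/-- Join an interior point `q` off the level to whichever of `a`, `b` lies on the other side: the
open segment is interior and crosses the level. -/
lemma exists_interior_height_eq {C : Set ℂ} (hC : Convex ℝ C) (hne : (interior C).Nonempty)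
    {ω c : ℝ} {a b : ℂ} (ha : a ∈ C) (hb : b ∈ C) (hac : height ω a < c) (hcb : c < height ω b) :
    ∃ q ∈ interior C, height ω q = c := by
  obtain ⟨q, hq⟩ := hne
  have key : ∀ b ∈ C, (height ω q - c) * (height ω b - c) < 0 →
      ∃ q ∈ interior C, height ω q = c := by
    intro b hb hlt
    set A := height ω q
    set B := height ω b
    have hAB : (A - B) ≠ 0 := fun h => by
      have : A = B := by linarith
      rw [this] at hlt
      nlinarith
    have h1 : 0 < (c - B) / (A - B) := by
      rw [div_pos_iff]
      rcases lt_or_gt_of_ne hAB with h | h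
      · right; exact ⟨by nlinarith, h⟩
      · left; exact ⟨by nlinarith, h⟩
    have h2 : 0 < (A - c) / (A - B) := by
      rw [div_pos_iff]
      rcases lt_or_gt_of_ne hAB with h | h
      · right; exact ⟨by nlinarith, h⟩
      · left; exact ⟨by nlinarith, h⟩
    have h3 : (c - B) / (A - B) + (A - c) / (A - B) = 1 := by field_simp; ring
    refine ⟨_, hC.openSegment_interior_self_subset_interior hq hb ⟨_, _, h1, h2, h3, rfl⟩, ?_⟩
    rw [height_combo]
    change (c - B) / (A - B) * A + (A - c) / (A - B) * B = c
    field_simp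
    ring
  rcases lt_trichotomy (height ω q) c with h | h | h
  · exact key b hb (by nlinarith)
  · exact ⟨q, hq, h⟩
  · exact key a ha (by nlinarith)

/-- A line through an interior point of a convex set has at most two points in common with
the complement of the interior. -/
lemma eq_or_eq_or_eq_of_height_eq {C : Set ℂ} (hC : Convex ℝ C) {ω : ℝ} {q : ℂ}
    (hq : q ∈ interior C) {x : Fin 3 → ℂ} (hx : ∀ i, x i ∈ C \ interior C)
    (hh : ∀ i, height ω (x i) = height ω q) : ∃ i j, i ≠ j ∧ x i = x j := by
  set e : ℂ := ⟨-sin ω, cos ω⟩ with he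
  have hs : ∀ i, ∃ s : ℝ, x i = q + s • e := fun i => by
    refine ⟨-((x i).re - q.re) * sin ω + ((x i).im - q.im) * cos ω, ?_⟩
    have h := hh i
    simp only [height] at h
    have hsc := sin_sq_add_cos_sq ω
    apply Complex.ext
    · simp only [he, Complex.add_re, Complex.smul_re, smul_eq_mul]
      linear_combination cos ω * h - ((x i).re - q.re) * hsc
    · simp only [he, Complex.add_im, Complex.smul_im, smul_eq_mul]
      linear_combination sin ω * h - ((x i).im - q.im) * hsc
  choose s hs using hs
  have hs0 (i) : s i ≠ 0 := fun h => (hx i).2 (by rwa [hs, h, zero_smul, add_zero])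
  -- Of two points on the same side of `q`, the nearer would lie on an open segment from `q` to a
  -- point of `C`, hence in the interior.
  have hnot (i j) (h : 0 < s i / s j) (h1 : s i / s j < 1) : False := by
    refine (hx i).2 (hC.openSegment_interior_self_subset_interior hq (hx j).1
      ⟨1 - s i / s j, s i / s j, by linarith, h, by ring, ?_⟩)
    rw [hs i, hs j, smul_add, smul_smul, div_mul_cancel₀ _ (hs0 j), sub_smul, one_smul]
    abel
  have hsame (i j) (h : 0 < s i / s j) : x i = x j := by
    have hji : s j / s i = (s i / s j)⁻¹ := (inv_div _ _).symm
    rcases lt_trichotomy (s i / s j) 1 with h1 | h1 | h1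
    · exact (hnot i j h h1).elim
    · rw [hs i, hs j, (div_eq_one_iff_eq (hs0 j)).1 h1]
    · exact (hnot j i (by rw [hji]; positivity) (by rw [hji]; exact inv_lt_one_of_one_lt₀ h1)).elim
  have hpos (i j) (h : (0 < s i) ↔ (0 < s j)) : 0 < s i / s j := by
    rcases lt_or_gt_of_ne (hs0 i) with h1 | h1
    · have h2 : s j < 0 := lt_of_le_of_ne (not_lt.1 (h.not.1 (not_lt.2 h1.le))) (hs0 j)
      exact div_pos_of_neg_of_neg h1 h2
    · exact div_pos h1 (h.1 h1)
  -- Among three points two lie on the same side of `q`.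
  obtain ⟨i, j, hij, h⟩ := Fintype.exists_ne_map_eq_of_card_lt (fun i => decide (0 < s i))
    (by simp)
  exact ⟨i, j, hij, hsame i j (hpos i j (by simpa using h))⟩

lemma IsConvexBody.eq_or_eq_or_eq_of_lev_eq {K : Set ℍ} (hK : IsConvexBody K) {O : ℍ} {ω c : ℝ}
    {a b : ℍ} (ha : a ∈ K) (hb : b ∈ K) (hac : lev O ω a < c) (hcb : c < lev O ω b)
    {x : Fin 3 → ℍ} (hx : ∀ i, x i ∈ frontier K) (hh : ∀ i, lev O ω (x i) = c) :
    ∃ i j, i ≠ j ∧ x i = x j := by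
  have hC := hK.convex.convex_klein O
  have hne : (interior (klein O '' K)).Nonempty := by
    rw [← klein_image_interior]; exact hK.interior_nonempty.image _
  have hac' := hac
  have hcb' := hcb
  rw [← hh 0, lev_lt_lev_iff] at hac' hcb'
  obtain ⟨q, hq, hqc⟩ := exists_interior_height_eq hC hne (mem_image_of_mem _ ha)
    (mem_image_of_mem _ hb) hac' hcb'
  obtain ⟨i, j, hij, h⟩ := eq_or_eq_or_eq_of_height_eq hC hq (x := fun i => klein O (x i))
    (ω := ω) (fun i => by
      rw [← klein_image_interior, ← image_sdiff (klein_injective O),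
        ← hK.isCompact.isClosed.frontier_eq]
      exact mem_image_of_mem _ (hx i))
    (fun i => by rw [hqc, ← lev_eq_lev_iff, hh, hh])
  exact ⟨i, j, hij, klein_injective O h⟩

lemma IsConvexBody.nonempty {K : Set ℍ} (hK : IsConvexBody K) : K.Nonempty :=
  hK.interior_nonempty.mono interior_subset

/-- A maximum is not interior, since a small Klein displacement in the direction `ω` raises the
height. -/
lemma IsConvexBody.exists_frontier_lev_eq_supp {K : Set ℍ} (hK : IsConvexBody K) (O : ℍ) (ω : ℝ) :
    ∃ z ∈ frontier K, lev O ω z = supp K O ω := by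
  obtain ⟨z, hz, h⟩ := exists_lev_eq_supp hK.isCompact hK.nonempty O ω
  refine ⟨z, ?_, h⟩
  rw [hK.isCompact.isClosed.frontier_eq]
  refine ⟨hz, fun hi => ?_⟩
  have hk : klein O z ∈ interior (klein O '' K) := by
    rw [← klein_image_interior]; exact mem_image_of_mem _ hi
  set e : ℂ := ⟨cos ω, sin ω⟩ with he
  have hcont : Tendsto (fun t : ℝ => klein O z + t • e) (𝓝[>] 0) (𝓝 (klein O z)) := by
    have : Continuous fun t : ℝ => klein O z + t • e := by fun_prop
    have h := this.tendsto 0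
    rw [zero_smul, add_zero] at h
    exact h.mono_left nhdsWithin_le_nhds
  obtain ⟨t, ht, ht0⟩ := ((hcont.eventually (isOpen_interior.mem_nhds hk)).and
    self_mem_nhdsWithin).exists
  obtain ⟨w, hw, hwt⟩ := interior_subset ht
  have h1 := lev_le_supp hK.isCompact O ω hw
  rw [← h, lev_le_lev_iff, hwt] at h1
  have h2 : height ω (klein O z + t • e) = height ω (klein O z) + t := by
    simp only [height, he, Complex.add_re, Complex.add_im, Complex.smul_re, Complex.smul_im,
      smul_eq_mul]
    linear_combination t * sin_sq_add_cos_sq ω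
  rw [h2] at h1
  have : (0 : ℝ) < t := ht0
  linarith

/-- The boundary of a convex body is a simple closed curve. -/
theorem IsConvexBody.exists_boundary_curve {K : Set ℍ} (hK : IsConvexBody K) :
    ∃ γ : ℝ → ℍ, Continuous γ ∧ γ 0 = γ 1 ∧ InjOn γ (Ico 0 1) ∧ γ '' Icc 0 1 = frontier K := by
  obtain ⟨O, -⟩ := hK.nonempty
  have hC := hK.convex.convex_klein O
  have hcomp := hK.isCompact.image (continuous_klein O)
  have hne : (interior (klein O '' K)).Nonempty := by
    rw [← klein_image_interior]; exact hK.interior_nonempty.image _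
  obtain ⟨h, -, -, hf⟩ := exists_homeomorph_image_interior_closure_frontier_eq_unitBall hC hne
    hcomp.isBounded
  have hsymm (k : ℂ) (hk : ‖k‖ = 1) : h.symm k ∈ klein O '' frontier K := by
    rw [klein_image_frontier O hK.isCompact]
    have : k ∈ h '' frontier (klein O '' K) := by rw [hf]; simpa using hk
    obtain ⟨l, hl, rfl⟩ := this
    rwa [h.symm_apply_apply]
  set E : ℝ → ℂ := fun t => Complex.exp ((2 * π * t : ℝ) * Complex.I) with hE
  have hEn (t) : ‖E t‖ = 1 := Complex.norm_exp_ofReal_mul_I _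
  have hE1 : E 0 = E 1 := by
    simp only [hE, mul_zero, mul_one, Complex.ofReal_zero, zero_mul, Complex.exp_zero]
    rw [Complex.ofReal_mul, Complex.ofReal_ofNat, Complex.exp_two_pi_mul_I]
  have hEinj : InjOn E (Ico 0 1) := by
    intro s hs t ht hst
    rw [hE, Complex.exp_eq_exp_iff_exists_int] at hst
    obtain ⟨n, hn⟩ := hst
    have h1 := congrArg Complex.im hn
    simp at h1
    have h2 : s = t + n := by
      have : 2 * π * s = 2 * π * (t + n) := by linarith
      exact mul_left_cancel₀ (by positivity) this
    have h3 : (n : ℝ) < 1 := by linarith [hs.2, ht.1]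
    have h4 : (-1 : ℝ) < n := by linarith [hs.1, ht.2]
    have h5 : n < 1 := by exact_mod_cast h3
    have h6 : -1 < n := by exact_mod_cast h4
    obtain rfl : n = 0 := by omega
    simpa using h2
  have hEsurj (k : ℂ) (hk : ‖k‖ = 1) : ∃ t ∈ Icc (0 : ℝ) 1, E t = k := by
    have hk' := Complex.norm_mul_exp_arg_mul_I k
    rw [hk, Complex.ofReal_one, one_mul] at hk'
    have ha := Complex.arg_mem_Ioc k
    have hpi := pi_pos
    rcases le_total 0 (Complex.arg k) with h0 | h0
    · refine ⟨Complex.arg k / (2 * π), ⟨by positivity, ?_⟩, ?_⟩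
      · rw [div_le_one (by positivity)]; linarith [ha.2]
      · rw [hE]
        simp only
        rw [mul_div_cancel₀ _ (by positivity), hk']
    · refine ⟨Complex.arg k / (2 * π) + 1, ⟨?_, ?_⟩, ?_⟩
      · rw [div_add_one (by positivity)]
        have := ha.1
        exact div_nonneg (by linarith) (by positivity)
      · have := div_nonpos_of_nonpos_of_nonneg h0 (by positivity : 0 ≤ 2 * π)
        linarith
      · rw [hE]
        simp only
        rw [mul_add, mul_div_cancel₀ _ (by positivity), mul_one, Complex.ofReal_add, add_mul,
          Complex.exp_add, hk', Complex.ofReal_mul, Complex.ofReal_ofNat, Complex.exp_two_pi_mul_I,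
          mul_one]
  have hmem (t) : h.symm (E t) ∈ Metric.ball (0 : ℂ) 1 := by
    obtain ⟨z, -, hz⟩ := hsymm _ (hEn t)
    rw [← hz]
    exact mem_ball_zero_iff.2 (norm_klein_lt_one O z)
  have hEc : Continuous E := by
    simp only [hE]
    fun_prop
  refine ⟨fun t => kleinInv O (h.symm (E t)), ?_, ?_, ?_, ?_⟩
  · exact (continuousOn_kleinInv O).comp_continuous (h.symm.continuous.comp hEc) hmem
  · simp only [hE1]
  · intro s hs t ht hst
    have h1 := congrArg (klein O) hst
    simp only [klein_kleinInv O (mem_ball_zero_iff.1 (hmem _))] at h1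
    exact hEinj hs ht (h.symm.injective h1)
  · ext z
    constructor
    · rintro ⟨t, -, rfl⟩
      obtain ⟨w, hw, hwt⟩ := hsymm _ (hEn t)
      simp only
      rwa [← hwt, kleinInv_klein]
    · intro hz
      have h1 : h (klein O z) ∈ Metric.sphere (0 : ℂ) 1 := by
        rw [← hf, ← klein_image_frontier O hK.isCompact]
        exact mem_image_of_mem _ (mem_image_of_mem _ hz)
      obtain ⟨t, ht, htk⟩ := hEsurj _ (mem_sphere_zero_iff_norm.1 h1)
      refine ⟨t, ht, ?_⟩
      simp only
      rw [htk, h.symm_apply_apply, kleinInv_klein]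

/-! ### Total oscillation of functions of one variable -/

/-- Banach's indicatrix: the sum is the integral over levels `c` of the number of cells whose values
at `s i` and `t i` straddle `c`. Each such cell contains a root of `f = c`, and there are at most
two roots. -/
lemma sum_abs_sub_le_of_level_le_two {f : ℝ → ℝ} (hf : Continuous f) {m M : ℝ} (hmM : m ≤ M)
    (hfm : ∀ t ∈ Icc (0 : ℝ) 1, f t ∈ Icc m M)
    (hlev : ∀ c ∈ Ioo m M, ∀ τ : Fin 3 → ℝ, (∀ i, τ i ∈ Ico (0 : ℝ) 1) → (∀ i, f (τ i) = c) →
      ∃ i j, i ≠ j ∧ τ i = τ j)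
    {n : ℕ} {s t : Fin (n + 1) → ℝ}
    (hs : ∀ i : Fin (n + 1), s i ∈ Icc ((i : ℝ) / (n + 1)) ((i + 1 : ℝ) / (n + 1)))
    (ht : ∀ i : Fin (n + 1), t i ∈ Icc ((i : ℝ) / (n + 1)) ((i + 1 : ℝ) / (n + 1))) :
    ∑ i, |f (s i) - f (t i)| ≤ 2 * (M - m) := by
  have hn : (0 : ℝ) < n + 1 := by positivity
  have hunit (i : Fin (n + 1)) : Icc ((i : ℝ) / (n + 1)) ((i + 1 : ℝ) / (n + 1)) ⊆ Icc 0 1 := by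
    apply Icc_subset_Icc (by positivity)
    rw [div_le_one hn]
    exact_mod_cast i.2
  -- Values at grid points form a null set; without them the roots are interior to the cells, so
  -- different cells give different roots.
  set V : Set ℝ := ((fun j : ℕ => f ((j : ℝ) / (n + 1))) '' Set.Iic (n + 1)) with hV
  have hVfin : V.Finite := (Set.finite_Iic _).image _
  set U : Fin (n + 1) → Set ℝ := fun i =>
    Ioo (min (f (s i)) (f (t i))) (max (f (s i)) (f (t i))) \ V with hU
  have hUm (i) : MeasurableSet (U i) := measurableSet_Ioo.diff hVfin.measurableSet
  have hUvol (i) : volume (U i) = ENNReal.ofReal |f (s i) - f (t i)| := by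
    rw [hU]
    simp only
    rw [measure_sdiff_null (hVfin.measure_zero _), Real.volume_Ioo, max_sub_min_eq_abs]
    rw [abs_sub_comm]
  have hUsub (i) : U i ⊆ Ioo m M := by
    intro c hc
    have h1 := hfm _ (hunit i (hs i))
    have h2 := hfm _ (hunit i (ht i))
    exact ⟨lt_of_le_of_lt (le_min h1.1 h2.1) hc.1.1, lt_of_lt_of_le hc.1.2 (max_le h1.2 h2.2)⟩
  have hroot (i c) (hc : c ∈ U i) :
      ∃ τ ∈ Ioo ((i : ℝ) / (n + 1)) ((i + 1 : ℝ) / (n + 1)), f τ = c := by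
    have hsub := intermediate_value_uIcc (a := s i) (b := t i) hf.continuousOn
    obtain ⟨τ, hτ, rfl⟩ := hsub ⟨hc.1.1.le, hc.1.2.le⟩
    have hτ' : τ ∈ Icc ((i : ℝ) / (n + 1)) ((i + 1 : ℝ) / (n + 1)) :=
      uIcc_subset_Icc (hs i) (ht i) hτ
    refine ⟨τ, ⟨lt_of_le_of_ne hτ'.1 fun h => hc.2 ?_, lt_of_le_of_ne hτ'.2 fun h => hc.2 ?_⟩, rfl⟩
    · exact ⟨i, i.2.le, by simp only [h]⟩
    · exact ⟨i + 1, i.2, by simp only [h, Nat.cast_add, Nat.cast_one]⟩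
  have hcount (c : ℝ) : ∑ i, (U i).indicator (1 : ℝ → ENNReal) c ≤
      (Ioo m M).indicator (fun _ => (2 : ENNReal)) c := by
    classical
    by_cases hc : c ∈ Ioo m M
    · rw [indicator_of_mem hc]
      have hcard : (Finset.univ.filter fun i => c ∈ U i).card ≤ 2 := by
        by_contra! hcard
        set e := Finset.orderEmbOfCardLe _ hcard
        have hmem : ∀ k, c ∈ U (e k) := fun k =>
          (Finset.mem_filter.1 (Finset.orderEmbOfCardLe_mem _ hcard k)).2
        choose τ hτ hτc using fun k => hroot _ c (hmem k)
        obtain ⟨i, j, hij, h⟩ := hlev c hc τ (fun k => by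
          have h1 := hunit _ (Ioo_subset_Icc_self (hτ k))
          refine ⟨h1.1, lt_of_lt_of_le (hτ k).2 ?_⟩
          rw [div_le_one hn]
          exact_mod_cast (e k).2) hτc
        refine hij (e.injective (Fin.ext ?_))
        have h1 := hτ i
        have h2 := hτ j
        rw [h] at h1
        have h3 := h1.1.trans h2.2
        have h4 := h2.1.trans h1.2
        rw [div_lt_div_iff_of_pos_right hn] at h3 h4
        have h5 : (e i : ℕ) < (e j : ℕ) + 1 := by exact_mod_cast h3
        have h6 : (e j : ℕ) < (e i : ℕ) + 1 := by exact_mod_cast h4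
        omega
      simp only [indicator_apply, Pi.one_apply]
      rw [← Finset.sum_filter, Finset.sum_const, nsmul_eq_mul, mul_one]
      exact_mod_cast hcard
    · rw [indicator_of_notMem hc]
      refine le_of_eq (Finset.sum_eq_zero fun i _ => indicator_of_notMem (fun h => hc (hUsub i h)) _)
  have h1 : ∑ i, volume (U i) ≤ ENNReal.ofReal (2 * (M - m)) := by
    calc ∑ i, volume (U i) = ∫⁻ c, ∑ i, (U i).indicator (1 : ℝ → ENNReal) c := by
          rw [lintegral_finsetSum _ fun i _ => measurable_one.indicator (hUm i)]
          simp only [lintegral_indicator_one (hUm _)]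
      _ ≤ ∫⁻ c, (Ioo m M).indicator (fun _ => (2 : ENNReal)) c := lintegral_mono hcount
      _ = ENNReal.ofReal (2 * (M - m)) := by
          rw [lintegral_indicator measurableSet_Ioo, setLIntegral_const, Real.volume_Ioo,
            ENNReal.ofReal_mul two_pos.le, ENNReal.ofReal_ofNat]
  simp only [hUvol] at h1
  rw [← ENNReal.ofReal_sum_of_nonneg fun i _ => abs_nonneg _] at h1
  exact (ENNReal.ofReal_le_ofReal_iff (by linarith)).1 h1

/-- A closed sequence passes between the indices `i` and `j` along two complementary arcs. -/
lemma two_mul_sub_le_sum_abs {a : ℕ → ℝ} {n : ℕ} (ha : a 0 = a n) {i j : ℕ} (hi : i ≤ n)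
    (hj : j ≤ n) : 2 * (a i - a j) ≤ ∑ k ∈ Finset.range n, |a k - a (k + 1)| := by
  have key : ∀ i j, i ≤ j → j ≤ n → 2 * |a i - a j| ≤
      ∑ k ∈ Finset.range n, |a k - a (k + 1)| := by
    intro i j hij hj
    have h1 := dist_le_Ico_sum_dist a (Nat.zero_le i)
    have h2 := dist_le_Ico_sum_dist a hij
    have h3 := dist_le_Ico_sum_dist a hj
    have h4 := Finset.sum_Ico_consecutive (fun k => dist (a k) (a (k + 1))) (Nat.zero_le i) hij
    have h5 := Finset.sum_Ico_consecutive (fun k => dist (a k) (a (k + 1))) (Nat.zero_le j) hj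
    rw [Finset.range_eq_Ico]
    simp only [Real.dist_eq] at *
    rw [ha] at h1
    have h6 := abs_sub_le (a j) (a n) (a i)
    rw [abs_sub_comm (a j) (a i)] at h6
    linarith
  rcases le_total i j with h | h
  · linarith [key i j h hj, le_abs_self (a i - a j)]
  · have := key j i h hi
    rw [abs_sub_comm] at this
    linarith [le_abs_self (a i - a j)]

/-! ### Hausdorff measure and diameter of arcs -/

lemma ofReal_dist_le_hausdorffMeasure_image {X : Type*} [MetricSpace X] [MeasurableSpace X]
    [BorelSpace X] {γ : ℝ → X} (hγ : Continuous γ) {a b : ℝ} (hab : a ≤ b) :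
    ENNReal.ofReal (dist (γ a) (γ b)) ≤ Measure.hausdorffMeasure 1 (γ '' Ico a b) := by
  set g : X → ℝ := fun x => dist x (γ a) with hg
  have hgl : LipschitzWith 1 g := LipschitzWith.dist_left (γ a)
  have h1 := hgl.hausdorffMeasure_image_le (zero_le_one) (γ '' Ico a b)
  rw [ENNReal.coe_one, ENNReal.one_rpow, one_mul, hausdorffMeasure_real] at h1
  refine le_trans ?_ h1
  -- The distance from `γ a` is 1-Lipschitz and already attains these values on the half-open arc;
  -- half-open arcs can later be disjoint.
  have h2 : Ico (0 : ℝ) (dist (γ a) (γ b)) ⊆ g '' (γ '' Ico a b) := by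
    have := intermediate_value_Ico hab (f := fun t => g (γ t)) (hgl.continuous.comp hγ).continuousOn
    simp only [hg, dist_self] at this
    rw [dist_comm, image_image]
    exact this
  calc ENNReal.ofReal (dist (γ a) (γ b)) = volume (Ico (0 : ℝ) (dist (γ a) (γ b))) := by
        rw [Real.volume_Ico, sub_zero]
    _ ≤ _ := measure_mono h2

lemma exists_ediam_eq_ofReal_dist {X : Type*} [MetricSpace X] {A : Set X} (hA : IsCompact A)
    (hne : A.Nonempty) : ∃ x ∈ A, ∃ y ∈ A, Metric.ediam A ≤ ENNReal.ofReal (dist x y) := by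
  obtain ⟨⟨x, y⟩, ⟨hx, hy⟩, h⟩ := (hA.prod hA).exists_isMaxOn (hne.prod hne)
    continuous_dist.continuousOn
  refine ⟨x, hx, y, hy, Metric.ediam_le fun u hu v hv => ?_⟩
  rw [edist_dist]
  exact ENNReal.ofReal_le_ofReal (h (mk_mem_prod hu hv))

/-! ### The perimeter -/

section Perimeter

variable {K : Set ℍ}

/-- Here `- supp K O (ω + π)` is the minimum of `lev O ω` when `K` is nonempty, so the integrand is
twice the width; the shift by `π` does not change the integral. -/
lemma integral_two_mul_width (hK : IsCompact K) (O : ℍ) :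
    ∫ ω in (0 : ℝ)..(2 * π), 2 * (supp K O ω - - supp K O (ω + π)) =
      4 * ∫ ω in (0 : ℝ)..(2 * π), supp K O ω := by
  have hc := continuous_supp hK O
  have h1 : ∫ ω in (0 : ℝ)..(2 * π), supp K O (ω + π) = ∫ ω in (0 : ℝ)..(2 * π), supp K O ω := by
    rw [intervalIntegral.integral_comp_add_right (supp K O), add_comm (2 * π) π, zero_add,
      (supp_add_two_pi K O).intervalIntegral_add_eq π 0, zero_add]
  simp only [sub_neg_eq_add]
  have hc' : Continuous fun ω => supp K O (ω + π) := by fun_prop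
  rw [intervalIntegral.integral_const_mul, intervalIntegral.integral_add
    (hc.intervalIntegrable _ _) (hc'.intervalIntegrable _ _), h1]
  ring

lemma sum_dist_eq_integral (O : ℍ) {ι : Type*} (s : Finset ι) (x y : ι → ℍ) :
    4 * ∑ i ∈ s, dist (x i) (y i) =
      ∫ ω in (0 : ℝ)..(2 * π), ∑ i ∈ s, |lev O ω (x i) - lev O ω (y i)| := by
  rw [intervalIntegral.integral_finsetSum fun i _ =>
    (continuous_abs_lev_sub O (x i) (y i)).intervalIntegrable _ _, Finset.mul_sum]
  simp only [integral_abs_lev_sub]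

lemma continuous_sum_abs_lev_sub (O : ℍ) {ι : Type*} (s : Finset ι) (x y : ι → ℍ) :
    Continuous fun ω => ∑ i ∈ s, |lev O ω (x i) - lev O ω (y i)| :=
  continuous_finsetSum _ fun i _ => continuous_abs_lev_sub O (x i) (y i)

lemma IsConvexBody.neg_supp_le_supp (hK : IsConvexBody K) (O : ℍ) (ω : ℝ) :
    - supp K O (ω + π) ≤ supp K O ω := by
  obtain ⟨z, hz⟩ := hK.nonempty
  exact (neg_supp_le_lev hK.isCompact O ω hz).trans (lev_le_supp hK.isCompact O ω hz)

lemma continuous_two_mul_width (hK : IsCompact K) (O : ℍ) :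
    Continuous fun ω => 2 * (supp K O ω - - supp K O (ω + π)) := by
  have hc := continuous_supp hK O
  fun_prop

lemma IsConvexBody.integral_supp_nonneg (hK : IsConvexBody K) (O : ℍ) :
    0 ≤ ∫ ω in (0 : ℝ)..(2 * π), supp K O ω := by
  have h := integral_two_mul_width hK.isCompact O
  have h1 : 0 ≤ ∫ ω in (0 : ℝ)..(2 * π), 2 * (supp K O ω - - supp K O (ω + π)) :=
    intervalIntegral.integral_nonneg (by positivity) fun ω _ => by
      linarith [hK.neg_supp_le_supp O ω]
  linarith

/-- In each direction the boundary meets every level strictly between the extremes at most twice, so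
the indicatrix bound applies and can be integrated. The pairs are arbitrary in their cells because
they will realise diameters of arcs. -/
lemma IsConvexBody.sum_dist_le (hK : IsConvexBody K) (O : ℍ) {γ : ℝ → ℍ} (hγ : Continuous γ)
    (hinj : InjOn γ (Ico 0 1)) (him : γ '' Icc 0 1 = frontier K) {n : ℕ} {s t : Fin (n + 1) → ℝ}
    (hs : ∀ i : Fin (n + 1), s i ∈ Icc ((i : ℝ) / (n + 1)) ((i + 1 : ℝ) / (n + 1)))
    (ht : ∀ i : Fin (n + 1), t i ∈ Icc ((i : ℝ) / (n + 1)) ((i + 1 : ℝ) / (n + 1))) :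
    ∑ i, dist (γ (s i)) (γ (t i)) ≤ ∫ ω in (0 : ℝ)..(2 * π), supp K O ω := by
  have hmem : ∀ u ∈ Icc (0 : ℝ) 1, γ u ∈ frontier K := fun u hu => by
    rw [← him]; exact mem_image_of_mem _ hu
  have hfr : frontier K ⊆ K := hK.isCompact.isClosed.frontier_subset
  have h : ∀ ω ∈ Icc (0 : ℝ) (2 * π), ∑ i, |lev O ω (γ (s i)) - lev O ω (γ (t i))| ≤
      2 * (supp K O ω - - supp K O (ω + π)) := by
    intro ω _
    refine sum_abs_sub_le_of_level_le_two (f := fun u => lev O ω (γ u))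
      ((continuous_lev O ω).comp hγ) (hK.neg_supp_le_supp O ω) (fun u hu => ?_)
      (fun c hc τ hτ hτc => ?_) hs ht
    · exact ⟨neg_supp_le_lev hK.isCompact O ω (hfr (hmem u hu)),
        lev_le_supp hK.isCompact O ω (hfr (hmem u hu))⟩
    · obtain ⟨b, hb, hbs⟩ := exists_lev_eq_supp hK.isCompact hK.nonempty O ω
      obtain ⟨a, ha, has⟩ := exists_lev_eq_supp hK.isCompact hK.nonempty O (ω + π)
      rw [lev_add_pi] at has
      obtain ⟨i, j, hij, h⟩ := hK.eq_or_eq_or_eq_of_lev_eq (O := O) (ω := ω) (c := c) ha hb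
        (by linarith [hc.1]) (by linarith [hc.2]) (x := fun i => γ (τ i))
        (fun i => hmem _ (Ico_subset_Icc_self (hτ i))) hτc
      exact ⟨i, j, hij, hinj (hτ i) (hτ j) h⟩
  have h1 := intervalIntegral.integral_mono_on (μ := volume)
    (by positivity : (0 : ℝ) ≤ 2 * π) ((continuous_sum_abs_lev_sub O Finset.univ (fun i => γ (s i))
      fun i => γ (t i)).intervalIntegrable _ _)
    ((continuous_two_mul_width hK.isCompact O).intervalIntegrable _ _) h
  rw [← sum_dist_eq_integral, integral_two_mul_width hK.isCompact O] at h1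
  linarith

theorem IsConvexBody.perimeter_le (hK : IsConvexBody K) (O : ℍ) :
    perimeter K ≤ ENNReal.ofReal (∫ ω in (0 : ℝ)..(2 * π), supp K O ω) := by
  obtain ⟨γ, hγ, -, hinj, him⟩ := hK.exists_boundary_curve
  set J : ∀ n : ℕ, Fin (n + 1) → Set ℝ := fun n i =>
    Icc ((i : ℝ) / (n + 1)) ((i + 1 : ℝ) / (n + 1)) with hJ
  have hJne (n i) : (J n i).Nonempty := by
    refine nonempty_Icc.2 ?_
    gcongr
    linarith
  have hJsub (n i) : J n i ⊆ Icc 0 1 := by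
    have hn : (0 : ℝ) < n + 1 := by positivity
    apply Icc_subset_Icc (by positivity)
    rw [div_le_one hn]
    exact_mod_cast i.2
  set A : ∀ n : ℕ, Fin (n + 1) → Set ℍ := fun n i => γ '' J n i with hA
  have hsmall : Tendsto (fun n => ⨆ i, Metric.ediam (A n i)) atTop (𝓝 0) := by
    rw [ENNReal.tendsto_nhds_zero]
    intro ε hε
    obtain ⟨δ, hδ, hδε⟩ : ∃ δ : ℝ, 0 < δ ∧ ENNReal.ofReal δ ≤ ε := by
      rcases eq_or_ne ε ⊤ with rfl | hε'
      · exact ⟨1, one_pos, le_top⟩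
      · exact ⟨ε.toReal, ENNReal.toReal_pos hε.ne' hε', ENNReal.ofReal_toReal_le⟩
    have huc := (isCompact_Icc (a := (0 : ℝ)) (b := 1)).uniformContinuousOn_of_continuous
      hγ.continuousOn
    rw [Metric.uniformContinuousOn_iff] at huc
    obtain ⟨η, hη, hh⟩ := huc δ hδ
    obtain ⟨N, hN⟩ := exists_nat_one_div_lt hη
    filter_upwards [eventually_ge_atTop N] with n hn
    refine iSup_le fun i => Metric.ediam_le ?_
    rintro _ ⟨u, hu, rfl⟩ _ ⟨v, hv, rfl⟩
    rw [edist_dist]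
    refine (ENNReal.ofReal_le_ofReal (hh u (hJsub n i hu) v (hJsub n i hv) ?_).le).trans hδε
    have h1 := Real.dist_le_of_mem_Icc hu hv
    have h2 : (i + 1 : ℝ) / (n + 1) - i / (n + 1) = 1 / (n + 1) := by ring
    have h3 := Nat.one_div_le_one_div (α := ℝ) hn
    linarith
  have hcover (n) : frontier K ⊆ ⋃ i, A n i := by
    rw [← him]
    rintro _ ⟨u, hu, rfl⟩
    have hn : (0 : ℝ) < n + 1 := by positivity
    rcases eq_or_lt_of_le hu.2 with h1 | h1
    · refine mem_iUnion.2 ⟨Fin.last n, mem_image_of_mem _ ⟨?_, ?_⟩⟩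
      · rw [h1, Fin.val_last, div_le_one hn]; linarith
      · rw [h1, Fin.val_last, div_self hn.ne']
    · have hfl : ⌊u * (n + 1)⌋₊ < n + 1 := by
        rw [Nat.floor_lt (mul_nonneg hu.1 hn.le)]
        push_cast
        nlinarith
      refine mem_iUnion.2 ⟨⟨_, hfl⟩, mem_image_of_mem _ ⟨?_, ?_⟩⟩
      · rw [div_le_iff₀ hn]
        exact Nat.floor_le (mul_nonneg hu.1 hn.le)
      · rw [le_div_iff₀ hn]
        exact (Nat.lt_floor_add_one _).le
  have hmain := Measure.hausdorffMeasure_le_liminf_sum 1 (frontier K) _ hsmall A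
    (Eventually.of_forall fun n i => le_iSup (fun i => Metric.ediam (A n i)) i)
    (Eventually.of_forall hcover)
  refine hmain.trans ?_
  refine (liminf_le_liminf (v := fun _ : ℕ =>
    ENNReal.ofReal (∫ ω in (0 : ℝ)..(2 * π), supp K O ω)) ?_).trans (by simp)
  refine Eventually.of_forall fun n => ?_
  simp only [ENNReal.rpow_one]
  have hex (i) : ∃ s ∈ J n i, ∃ t ∈ J n i,
      Metric.ediam (A n i) ≤ ENNReal.ofReal (dist (γ s) (γ t)) := by
    obtain ⟨_, ⟨s, hs, rfl⟩, _, ⟨t, ht, rfl⟩, h⟩ := exists_ediam_eq_ofReal_dist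
      (A := A n i) (isCompact_Icc.image hγ) ((hJne n i).image _)
    exact ⟨s, hs, t, ht, h⟩
  choose s hs t ht hst using hex
  calc ∑ i, Metric.ediam (A n i) ≤ ∑ i, ENNReal.ofReal (dist (γ (s i)) (γ (t i))) :=
        Finset.sum_le_sum fun i _ => hst i
    _ = ENNReal.ofReal (∑ i, dist (γ (s i)) (γ (t i))) :=
        (ENNReal.ofReal_sum_of_nonneg fun i _ => dist_nonneg).symm
    _ ≤ _ := ENNReal.ofReal_le_ofReal (hK.sum_dist_le O hγ hinj him hs ht)

/-- Half-open arcs of an injective curve are disjoint Borel sets, so their measures add, and each is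
at least its chord. -/
lemma ofReal_sum_dist_le_hausdorffMeasure {γ : ℝ → ℍ} (hγ : Continuous γ)
    (hinj : InjOn γ (Ico 0 1)) (n : ℕ) :
    ENNReal.ofReal (∑ k ∈ Finset.range (n + 1),
      dist (γ ((k : ℝ) / (n + 1))) (γ (((k + 1 : ℕ) : ℝ) / (n + 1)))) ≤
      Measure.hausdorffMeasure 1 (γ '' Icc 0 1) := by
  have hn : (0 : ℝ) < n + 1 := by positivity
  set I : ℕ → Set ℝ := fun k => Ico ((k : ℝ) / (n + 1)) (((k + 1 : ℕ) : ℝ) / (n + 1)) with hI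
  have hsub : ∀ k ∈ Finset.range (n + 1), I k ⊆ Ico 0 1 := by
    intro k hk
    apply Ico_subset_Ico (by positivity)
    rw [div_le_one hn]
    exact_mod_cast Finset.mem_range.1 hk
  have hdisj : Pairwise (Function.onFun Disjoint I) := by
    intro i j hij
    refine Set.disjoint_left.2 fun u hu hv => hij ?_
    have h3 := hu.1.trans_lt hv.2
    have h4 := hv.1.trans_lt hu.2
    rw [div_lt_div_iff_of_pos_right hn] at h3 h4
    have h5 : i < j + 1 := by exact_mod_cast h3
    have h6 : j < i + 1 := by exact_mod_cast h4
    omega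
  rw [ENNReal.ofReal_sum_of_nonneg fun k _ => dist_nonneg]
  calc ∑ k ∈ Finset.range (n + 1),
        ENNReal.ofReal (dist (γ ((k : ℝ) / (n + 1))) (γ (((k + 1 : ℕ) : ℝ) / (n + 1))))
      ≤ ∑ k ∈ Finset.range (n + 1), Measure.hausdorffMeasure 1 (γ '' I k) := by
        refine Finset.sum_le_sum fun k _ => ofReal_dist_le_hausdorffMeasure_image hγ ?_
        gcongr
        simp
    _ = Measure.hausdorffMeasure 1 (⋃ k ∈ Finset.range (n + 1), γ '' I k) := by
        rw [measure_biUnion_finset]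
        · intro i hi j hj hij
          exact (hdisj hij).image hinj (hsub i hi) (hsub j hj)
        · intro k hk
          exact measurableSet_Ico.image_of_continuousOn_injOn hγ.continuousOn
            (hinj.mono (hsub k hk))
    _ ≤ _ := by
        refine measure_mono (iUnion₂_subset fun k hk => image_mono ?_)
        exact (hsub k hk).trans Ico_subset_Icc_self

lemma IsConvexBody.exists_sum_dist_ge (hK : IsConvexBody K) (O : ℍ) {γ : ℝ → ℍ}
    (hγ : Continuous γ) (hclosed : γ 0 = γ 1) (him : γ '' Icc 0 1 = frontier K) {ε : ℝ}
    (hε : 0 < ε) : ∃ n : ℕ, ∫ ω in (0 : ℝ)..(2 * π), supp K O ω ≤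
      ∑ k ∈ Finset.range (n + 1),
        dist (γ ((k : ℝ) / (n + 1))) (γ (((k + 1 : ℕ) : ℝ) / (n + 1))) + 2 * π * ε := by
  have hF : Continuous fun p : ℝ × ℝ => lev O p.1 (γ p.2) :=
    (continuous_lev_uncurry O).comp (continuous_fst.prodMk (hγ.comp continuous_snd))
  have huc := ((isCompact_Icc (a := (0 : ℝ)) (b := 2 * π)).prod
    (isCompact_Icc (a := (0 : ℝ)) (b := 1))).uniformContinuousOn_of_continuous hF.continuousOn
  rw [Metric.uniformContinuousOn_iff] at huc
  obtain ⟨η, hη, hh⟩ := huc ε hε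
  obtain ⟨n, hnη⟩ := exists_nat_one_div_lt hη
  have hn : (0 : ℝ) < n + 1 := by positivity
  have happrox : ∀ u ∈ Icc (0 : ℝ) 1, ∃ k ≤ n + 1, ∀ ω ∈ Icc (0 : ℝ) (2 * π),
      |lev O ω (γ u) - lev O ω (γ ((k : ℝ) / (n + 1)))| < ε := by
    intro u hu
    have hfl : ⌊u * (n + 1)⌋₊ ≤ n + 1 := by
      apply Nat.floor_le_of_le
      push_cast
      nlinarith [hu.2]
    refine ⟨_, hfl, fun ω hω => ?_⟩
    have h1 := Nat.floor_le (mul_nonneg hu.1 hn.le)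
    have h2 := Nat.lt_floor_add_one (u * (n + 1 : ℝ))
    generalize ⌊u * (n + 1 : ℝ)⌋₊ = k at *
    have hk : (k : ℝ) / (n + 1) ∈ Icc (0 : ℝ) 1 :=
      ⟨by positivity, by rw [div_le_one hn]; exact_mod_cast hfl⟩
    have := hh (ω, u) ⟨hω, hu⟩ (ω, (k : ℝ) / (n + 1)) ⟨hω, hk⟩ ?_
    · rwa [Real.dist_eq] at this
    · rw [Prod.dist_eq, dist_self, max_lt_iff]
      refine ⟨hη, lt_of_le_of_lt ?_ hnη⟩
      rw [Real.dist_eq, abs_of_nonneg (by rw [sub_nonneg, div_le_iff₀ hn]; exact h1),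
        sub_le_iff_le_add, ← add_div, le_div_iff₀ hn]
      linarith
  refine ⟨n, ?_⟩
  -- Moving the maximum and the minimum to grid points costs `ε` each, doubled by the two arcs;
  -- after integration and division by 4 the loss is `2 * π * ε`.
  have h : ∀ ω ∈ Icc (0 : ℝ) (2 * π), 2 * (supp K O ω - - supp K O (ω + π)) - 4 * ε ≤
      ∑ k ∈ Finset.range (n + 1),
        |lev O ω (γ ((k : ℝ) / (n + 1))) - lev O ω (γ (((k + 1 : ℕ) : ℝ) / (n + 1)))| := by
    intro ω hω
    obtain ⟨b, hb, hbs⟩ := hK.exists_frontier_lev_eq_supp O ω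
    obtain ⟨a, ha, has⟩ := hK.exists_frontier_lev_eq_supp O (ω + π)
    rw [lev_add_pi] at has
    rw [← him] at ha hb
    obtain ⟨u, hu, rfl⟩ := ha
    obtain ⟨v, hv, rfl⟩ := hb
    obtain ⟨j, hj, hju⟩ := happrox u hu
    obtain ⟨i, hi, hiv⟩ := happrox v hv
    have h1 := abs_lt.1 (hju ω hω)
    have h2 := abs_lt.1 (hiv ω hω)
    have h3 := two_mul_sub_le_sum_abs (a := fun k => lev O ω (γ ((k : ℝ) / (n + 1))))
      (n := n + 1) (by
        simp only [Nat.cast_zero, zero_div, Nat.cast_add, Nat.cast_one]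
        rw [div_self hn.ne', hclosed]) hi hj
    linarith [h1.1, h1.2, h2.1, h2.2]
  have hw := continuous_two_mul_width hK.isCompact O
  have h1 := intervalIntegral.integral_mono_on (μ := volume)
    (by positivity : (0 : ℝ) ≤ 2 * π) ((hw.sub continuous_const).intervalIntegrable _ _)
    ((continuous_sum_abs_lev_sub O (Finset.range (n + 1)) (fun k : ℕ => γ ((k : ℝ) / (n + 1)))
      fun k : ℕ => γ (((k + 1 : ℕ) : ℝ) / (n + 1))).intervalIntegrable _ _) h
  simp only [Pi.sub_apply] at h1
  rw [← sum_dist_eq_integral, intervalIntegral.integral_sub (hw.intervalIntegrable _ _)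
    (continuous_const.intervalIntegrable _ _), integral_two_mul_width hK.isCompact O,
    intervalIntegral.integral_const, smul_eq_mul] at h1
  linarith

theorem IsConvexBody.perimeter_eq (hK : IsConvexBody K) (O : ℍ) :
    perimeter K = ENNReal.ofReal (∫ ω in (0 : ℝ)..(2 * π), supp K O ω) := by
  refine le_antisymm (hK.perimeter_le O) ?_
  have hfin : perimeter K ≠ ⊤ := ((hK.perimeter_le O).trans_lt ENNReal.ofReal_lt_top).ne
  obtain ⟨γ, hγ, hclosed, hinj, him⟩ := hK.exists_boundary_curve
  refine ENNReal.ofReal_le_of_le_toReal (le_of_forall_pos_le_add fun δ hδ => ?_)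
  obtain ⟨n, hn⟩ := hK.exists_sum_dist_ge O hγ hclosed him (ε := δ / (2 * π)) (by positivity)
  rw [mul_div_cancel₀ _ (by positivity)] at hn
  have h1 := ofReal_sum_dist_le_hausdorffMeasure hγ hinj n
  rw [him] at h1
  have h2 := (ENNReal.ofReal_le_iff_le_toReal hfin).1 h1
  linarith

end Perimeter

end HypCauchy

theorem mainTheorem7 (K : Set UpperHalfPlane) (hK : HypCauchy.IsConvexBody K)
    (O : UpperHalfPlane) (θ₀ : ℝ) :
    ∃ r : ℝ → ℝ,
      (∀ ω s : ℝ, (∃ L : Set UpperHalfPlane, HypCauchy.IsSupportLineAt K O (θ₀ + ω) s L) ↔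
        s = r ω) ∧
      IntervalIntegrable (fun ω => Real.sinh (r ω)) volume 0 (2 * Real.pi) ∧
      HypCauchy.perimeter K ≠ ⊤ ∧
      (HypCauchy.perimeter K).toReal = ∫ ω in (0 : ℝ)..(2 * Real.pi), Real.sinh (r ω) := by
  have hc := HypCauchy.continuous_supp hK.isCompact O
  have hper := hK.perimeter_eq O
  refine ⟨fun ω => Real.arsinh (HypCauchy.supp K O (θ₀ + ω)), fun ω s =>
    HypCauchy.exists_isSupportLineAt_iff hK.isCompact hK.nonempty O _ s, ?_, ?_, ?_⟩
  · simp only [Real.sinh_arsinh]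
    exact (hc.comp (continuous_const_add θ₀)).intervalIntegrable _ _
  · rw [hper]
    exact ENNReal.ofReal_ne_top
  · simp only [Real.sinh_arsinh]
    rw [hper, ENNReal.toReal_ofReal (hK.integral_supp_nonneg O),
      -- Periodicity of `supp` removes the reference direction `θ₀`.
      intervalIntegral.integral_comp_add_left (HypCauchy.supp K O), add_zero,
      (HypCauchy.supp_add_two_pi K O).intervalIntegral_add_eq θ₀ 0, zero_add]
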